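/- Let $N\ge 1$. For $j=1,2$ let $A^{(j)}\subset\mathbb{R}^2\cong\mathbb{C}$ be an $N$-layer concentric disk with centre $z^{(j)}$, radii $r^{(j)}_1>r^{(j)}_2>\dots>r^{(j)}_N>0$ and conductivities $\sigma^{(j)}_1,\dots,\sigma^{(j)}_N>0$: the background $A^{(j)}_0=\{|x-z^{(j)}|>r^{(j)}_1\}$ has conductivity $\sigma^{(j)}_0=1$, the layer $A^{(j)}_k=\{r^{(j)}_{k+1}<|x-z^{(j)}|\le r^{(j)}_k\}$ (with $A^{(j)}_N=\{|x-z^{(j)}|\le r^{(j)}_N\}$) has conductivity $\sigma^{(j)}_k$, and $\sigma^{(j)}_k\ne\sigma^{(j)}_{k-1}$ for $k=1,\dots,N$. The conductivities $\sigma^{(1)}_k$ and $\sigma^{(2)}_k$ are not assumed to be equal or known, nor are the centres. For a background potential $H$, a solution of the conductivity problem for $A^{(j)}$ is a continuous function $u:\mathbb{R}^2\to\mathbb{C}$ that is harmonic in the interior of each layer $A^{(j)}_0,\dots,A^{(j)}_N$, whose normal derivative extends continuously from either side to each interface $\Gamma_k=\{|x-z^{(j)}|=r^{(j)}_k\}$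 with $\sigma^{(j)}_{k-1}\,\partial_\nu u|_+=\sigma^{(j)}_k\,\partial_\nu u|_-$ on $\Gamma_k$, and for which $u-H=O(|x|^{-1})$ as $|x|\to\infty$. Let $\Omega$ be a bounded domain with $A^{(1)}\cup A^{(2)}\subset\Omega$, and let $\Pi$ be a nonempty relatively open subset of $\partial\Omega$ without isolated points. Let $(H_i)_{i\in I}$ be one background potential or a family of them, of the form $$H_i=\sum_{n=0}^{\infty}a_{i,n}\,r^n e^{\mathrm{i}n\theta},\qquad a_{i,n}\in\mathbb{C},\quad x=(r\cos\theta,r\sin\theta),$$ convergent in all of $\mathbb{R}^2$, in which modes of arbitrarily large order occur: for every $m$ there are $i\in I$ and $n\ge m$ with $a_{i,n}\ne0$. (For a single potential $H$ this says that infinitely many of its coefficients are nonzero; the probing waves $H_n=r^ne^{\mathrm{i}n\theta}$, $n\ge n_0$, are another example.) For each $i\in I$ let $u_{1,i}$ and $u_{2,i}$ be solutions of the conductivity problem with background potential $H_i$ for $A^{(1)}$ and $A^{(2)}$, respectively. If $u_{1,i}=u_{2,i}$ on $\Pi$ for every $i\in I$, then the two structures have the same centre, $z^{(1)}=z^{(2)}$,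 and the same radii, $$r^{(1)}_k=r^{(2)}_k,\qquad k=1,2,\dots,N.$$ -/

import Mathlib

open Filter Topology Asymptotics

/-- `N` concentric layers in the plane `ℝ² = ℂ`, embedded in a background of conductivity `1`.
The interfaces are the circles `|z - center| = radius k` with `k = 0, …, N - 1` (numbered from
the outermost to the innermost one: `radius k` is the classical `r_{k+1}`). The conductivities
are `cond 0 = 1` (background), `cond 1`, …, `cond N` (innermost disk); they are positive and jump
across every interface. -/
structure LayeredDisk (N : ℕ) where
  center : ℂ
  radius : Fin N → ℝ
  cond : Fin (N + 1) → ℝ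
  radius_pos : ∀ k, 0 < radius k
  radius_strictAnti : StrictAnti radius
  cond_zero : cond 0 = 1
  cond_pos : ∀ k, 0 < cond k
  cond_ne : ∀ k : Fin N, cond k.succ ≠ cond k.castSucc

namespace LayeredDisk

variable {N : ℕ}

/-- The interior of the `k`-th layer, i.e. `r_{k+1} < |z - center| < r_k` in the classical
numbering: the unbounded exterior for `k = 0`, an annulus for `0 < k < N`, and the innermost
disk (with its centre) for `k = N`. -/
def layer (D : LayeredDisk N) (k : Fin (N + 1)) : Set ℂ :=
  {z | (∀ i : Fin N, k ≤ i.castSucc → D.radius i < dist z D.center) ∧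
       (∀ i : Fin N, i.castSucc < k → dist z D.center < D.radius i)}

/-- The `k`-th interface; it separates the layers `k.castSucc` (outside) and `k.succ` (inside). -/
def interface (D : LayeredDisk N) (k : Fin N) : Set ℂ :=
  Metric.sphere D.center (D.radius k)

/-- The whole inclusion: the union of the closed disks bounded by the interfaces,
that is, the largest of them. -/
def inclusion (D : LayeredDisk N) : Set ℂ :=
  ⋃ k : Fin N, Metric.closedBall D.center (D.radius k)

/-- The derivative of `u` in the outward direction normal to the circles about the centre. -/
noncomputable def normalDeriv (D : LayeredDisk N) (u : ℂ → ℂ) (z : ℂ) : ℂ :=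
  fderiv ℝ u z (‖z - D.center‖⁻¹ • (z - D.center))

/-- `u` solves the conductivity problem `∇ · (σ ∇u) = 0` in `ℝ²`, `u - H = O(|z|⁻¹)` at infinity,
where `σ` is the piecewise constant conductivity of `D`, in the form of the classical transmission
problem: `u` is harmonic in the interior of each layer, it is continuous across the interfaces,
its normal derivative has one-sided limits at every point of every interface, and the flux
`σ ∂u/∂ν` does not jump. -/
structure IsSolution (D : LayeredDisk N) (H u : ℂ → ℂ) : Prop where
  continuous : Continuous u
  harmonic : ∀ k : Fin (N + 1), InnerProductSpace.HarmonicOnNhd u (D.layer k)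
  flux : ∀ k : Fin N, ∀ x ∈ D.interface k, ∃ dOut dIn : ℂ,
    Tendsto (D.normalDeriv u) (𝓝[D.layer k.castSucc] x) (𝓝 dOut) ∧
    Tendsto (D.normalDeriv u) (𝓝[D.layer k.succ] x) (𝓝 dIn) ∧
    (D.cond k.castSucc : ℂ) * dOut = (D.cond k.succ : ℂ) * dIn
  decay : (fun z => u z - H z) =O[cocompact ℂ] (fun z => ‖z‖⁻¹)

end LayeredDisk

/-!
Probing a concentric multilayer disk with entire potentials: the field measured on a set with an
accumulation point outside the disk determines the centre and the radii.

Fix a solution `u` with background potential `H`, and expand it in Fourier series on the circles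
about the centre `c`. In each layer the functions `(z - c) ∂u/∂z` and `conj (z - c) ∂u/∂z̄` are
holomorphic and antiholomorphic, so by Cauchy's theorem on annuli their Fourier coefficients of
order `n` are `A r ^ n` and `B r ^ (-n)`. Their difference and sum are the coefficients of
`-i ∂u/∂θ` and `r ∂u/∂r`, so the transmission conditions become linear relations between the
amplitudes `A`, `B` of adjacent layers (`amplitudes_at_interface`). Together with regularity at the
centre, these give `B = -X_n A` in the exterior for `n ≥ 0` (`eq_neg_reflCoeff_mul`), where the
reflection coefficient `X_n` is obtained by composing Möbius transformations, one for each
interface. Together with the decay of `u - H`, this identifies `u - H` in the exterior as the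
conjugate of `G (1 / (z - c))`, where `G` is the entire function with the coefficients
`conj (X_n b_n)` and the `b_n` are the Taylor coefficients of `H` about `c`
(`conj_sub_eq_scattered`).

For two structures with the same data on `S`, the identity theorem gives
`G₁ (1 / (z - c₁)) = G₂ (1 / (z - c₂))` on the plane punctured at the centres. If `c₁ ≠ c₂`, this
common function extends to an entire function that tends to `0` at infinity, so `G₁ = 0` by
Liouville's theorem. Since `X_n ≠ 0` for all large `n`, the background potentials would then be
polynomials of bounded degree. Hence `c₁ = c₂`, and the two sequences of reflection coefficients
agree for infinitely many `n`. Asymptotically `X_n ~ κ ρ ^ (2 n)` with the outermost radius `ρ` and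
the contrast `κ ≠ 0` across it, so both are determined; the Möbius transformation of the outermost
interface can then be inverted, and the remaining radii follow by induction
(`radius_eq_of_frequently_reflCoeff_eq`).
-/

open scoped ComplexConjugate

/-! ### Reflection coefficients -/

/-- The reflection coefficient of order `n` of `N` concentric layers. It is computed from the
innermost interface outwards: an interface of radius `ρ 0` and contrast `κ 0` composes the
coefficient `X` of the layers inside it with a Möbius transformation. -/
noncomputable def reflCoeff : (N : ℕ) → (Fin N → ℝ) → (Fin N → ℝ) → ℕ → ℝ
  | 0, _, _, _ => 0
  | N + 1, ρ, κ, n =>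
    ρ 0 ^ (2 * n) * ((κ 0 + reflCoeff N (Fin.tail ρ) (Fin.tail κ) n / ρ 0 ^ (2 * n)) /
      (1 + κ 0 * (reflCoeff N (Fin.tail ρ) (Fin.tail κ) n / ρ 0 ^ (2 * n))))

lemma one_add_mul_pos_of_abs_lt_one {k y : ℝ} (hk : |k| < 1) (hy : |y| < 1) : 0 < 1 + k * y := by
  have h : |k * y| < 1 := by
    rw [abs_mul]
    nlinarith [abs_nonneg k, abs_nonneg y]
  linarith [neg_lt_of_abs_lt h]

/-- The Möbius transformations `y ↦ (k + y) / (1 + k y)` preserve the unit interval. -/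
lemma abs_moebius_lt_one {k y : ℝ} (hk : |k| < 1) (hy : |y| < 1) :
    |(k + y) / (1 + k * y)| < 1 := by
  have h := one_add_mul_pos_of_abs_lt_one hk hy
  obtain ⟨hk1, hk2⟩ := abs_lt.1 hk
  obtain ⟨hy1, hy2⟩ := abs_lt.1 hy
  rw [abs_div, abs_of_pos h, div_lt_one h, abs_lt]
  constructor <;> nlinarith

lemma moebius_injOn {k y y' : ℝ} (hk : |k| < 1) (hy : |y| < 1) (hy' : |y'| < 1)
    (h : (k + y) / (1 + k * y) = (k + y') / (1 + k * y')) : y = y' := by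
  have h1 := one_add_mul_pos_of_abs_lt_one hk hy
  have h2 := one_add_mul_pos_of_abs_lt_one hk hy'
  rw [div_eq_div_iff h1.ne' h2.ne'] at h
  have h3 : (1 - k ^ 2) * (y - y') = 0 := by linear_combination h
  have h4 : 0 < 1 - k ^ 2 := by
    rw [← sq_abs]; nlinarith [abs_nonneg k]
  rcases mul_eq_zero.1 h3 with h5 | h5 <;> linarith

lemma Fin.tail_strictAnti {N : ℕ} {ρ : Fin (N + 1) → ℝ} (h : StrictAnti ρ) :
    StrictAnti (Fin.tail ρ) :=
  fun _ _ hij => h (Fin.succ_lt_succ_iff.2 hij)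

lemma abs_reflCoeff_lt {N : ℕ} {ρ κ : Fin N → ℝ} (hρ : ∀ k, 0 < ρ k) (hanti : StrictAnti ρ)
    (hκ : ∀ k, |κ k| < 1) {R : ℝ} (hR : 0 < R) (hle : ∀ k, ρ k ≤ R) (n : ℕ) :
    |reflCoeff N ρ κ n| < R ^ (2 * n) := by
  induction N generalizing R with
  | zero => simpa [reflCoeff] using pow_pos hR _
  | succ N ih =>
    have hp : 0 < ρ 0 ^ (2 * n) := pow_pos (hρ 0) _
    have h := ih (ρ := Fin.tail ρ) (κ := Fin.tail κ) (fun k => hρ k.succ)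
      (Fin.tail_strictAnti hanti) (fun k => hκ k.succ) (hρ 0)
      (fun k => (hanti (Fin.succ_pos k)).le)
    rw [reflCoeff, abs_mul, abs_of_pos hp]
    have hy : |reflCoeff N (Fin.tail ρ) (Fin.tail κ) n / ρ 0 ^ (2 * n)| < 1 := by
      rwa [abs_div, abs_of_pos hp, div_lt_one hp]
    calc _ < ρ 0 ^ (2 * n) * 1 := mul_lt_mul_of_pos_left (abs_moebius_lt_one (hκ 0) hy) hp
      _ ≤ R ^ (2 * n) := by
        rw [mul_one]; exact pow_le_pow_left₀ (hρ 0).le (hle 0) _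

lemma abs_reflCoeff_tail_div_lt_one {N : ℕ} {ρ κ : Fin (N + 1) → ℝ} (hρ : ∀ k, 0 < ρ k)
    (hanti : StrictAnti ρ) (hκ : ∀ k, |κ k| < 1) (n : ℕ) :
    |reflCoeff N (Fin.tail ρ) (Fin.tail κ) n / ρ 0 ^ (2 * n)| < 1 := by
  have hp : 0 < ρ 0 ^ (2 * n) := pow_pos (hρ 0) _
  rw [abs_div, abs_of_pos hp, div_lt_one hp]
  exact abs_reflCoeff_lt (fun k => hρ k.succ) (Fin.tail_strictAnti hanti) (fun k => hκ k.succ)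
    (hρ 0) (fun k => (hanti (Fin.succ_pos k)).le) n

/-- For large `n` only the outermost interface is visible. -/
lemma tendsto_reflCoeff_div {N : ℕ} {ρ κ : Fin (N + 1) → ℝ} (hρ : ∀ k, 0 < ρ k)
    (hanti : StrictAnti ρ) (hκ : ∀ k, |κ k| < 1) :
    Tendsto (fun n => reflCoeff (N + 1) ρ κ n / ρ 0 ^ (2 * n)) atTop (𝓝 (κ 0)) := by
  obtain ⟨R, hR, hRρ, hle⟩ : ∃ R, 0 < R ∧ R < ρ 0 ∧ ∀ k : Fin N, ρ k.succ ≤ R := by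
    cases N with
    | zero => exact ⟨ρ 0 / 2, half_pos (hρ 0), half_lt_self (hρ 0), fun k => k.elim0⟩
    | succ N =>
      refine ⟨ρ 1, hρ 1, hanti (by simp), fun k => hanti.antitone ?_⟩
      rw [← Fin.succ_zero_eq_one]
      exact Fin.succ_le_succ_iff.2 (Fin.zero_le k)
  have hy : Tendsto (fun n => reflCoeff N (Fin.tail ρ) (Fin.tail κ) n / ρ 0 ^ (2 * n)) atTop
      (𝓝 0) := by
    have h0 : Tendsto (fun n : ℕ => ((R / ρ 0) ^ 2) ^ n) atTop (𝓝 0) := by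
      refine tendsto_pow_atTop_nhds_zero_of_lt_one (by positivity) ?_
      have h1 : R / ρ 0 < 1 := (div_lt_one (hρ 0)).2 hRρ
      have h2 : 0 < R / ρ 0 := div_pos hR (hρ 0)
      nlinarith
    refine squeeze_zero_norm (fun n => ?_) h0
    have hp : 0 < ρ 0 ^ (2 * n) := pow_pos (hρ 0) _
    rw [Real.norm_eq_abs, abs_div, abs_of_pos hp, ← pow_mul, div_pow]
    exact div_le_div_of_nonneg_right (abs_reflCoeff_lt (ρ := Fin.tail ρ) (fun k => hρ k.succ)
      (Fin.tail_strictAnti hanti) (fun k => hκ k.succ) hR hle n).le hp.le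
  have h := (tendsto_const_nhds (x := κ 0)).add hy |>.div
    ((tendsto_const_nhds (x := (1 : ℝ))).add ((tendsto_const_nhds (x := κ 0)).mul hy)) (by simp)
  simp only [add_zero, mul_zero, div_one] at h
  refine h.congr fun n => ?_
  rw [reflCoeff, mul_div_cancel_left₀ _ (pow_pos (hρ 0) _).ne']
  rfl

/-- If the reflection coefficients of two structures agree for infinitely many orders, then the
outer radius of the second is not larger: otherwise its coefficients would dominate. -/
lemma not_radius_lt_of_frequently_reflCoeff_eq {N : ℕ} {ρ κ ρ' κ' : Fin (N + 1) → ℝ}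
    (hρ : ∀ k, 0 < ρ k) (hanti : StrictAnti ρ) (hκ : ∀ k, |κ k| < 1)
    (hρ' : ∀ k, 0 < ρ' k) (hanti' : StrictAnti ρ') (hκ' : ∀ k, |κ' k| < 1) (h0' : κ' 0 ≠ 0)
    (h : ∃ᶠ n in atTop, reflCoeff (N + 1) ρ κ n = reflCoeff (N + 1) ρ' κ' n) :
    ¬ ρ 0 < ρ' 0 := by
  intro hlt
  have h0 : Tendsto (fun n : ℕ => ((ρ 0 / ρ' 0) ^ 2) ^ n) atTop (𝓝 0) := by
    refine tendsto_pow_atTop_nhds_zero_of_lt_one (by positivity) ?_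
    have h1 : ρ 0 / ρ' 0 < 1 := (div_lt_one (hρ' 0)).2 hlt
    have h2 : 0 < ρ 0 / ρ' 0 := div_pos (hρ 0) (hρ' 0)
    nlinarith
  have h1 := (tendsto_reflCoeff_div hρ hanti hκ).mul h0
  rw [mul_zero] at h1
  refine h0' (tendsto_nhds_unique_of_frequently_eq (tendsto_reflCoeff_div hρ' hanti' hκ') h1
    (h.mono fun n hn => ?_))
  have hp : 0 < ρ 0 ^ (2 * n) := pow_pos (hρ 0) _
  rw [← hn, ← pow_mul, div_pow]
  field_simp

/-- The radii are determined by the reflection coefficients of infinitely many orders: the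
outermost interface is read off from the asymptotics, and can then be stripped off. -/
theorem radius_eq_of_frequently_reflCoeff_eq {N : ℕ} {ρ κ ρ' κ' : Fin N → ℝ}
    (hρ : ∀ k, 0 < ρ k) (hanti : StrictAnti ρ) (hκ : ∀ k, |κ k| < 1) (h0 : ∀ k, κ k ≠ 0)
    (hρ' : ∀ k, 0 < ρ' k) (hanti' : StrictAnti ρ') (hκ' : ∀ k, |κ' k| < 1) (h0' : ∀ k, κ' k ≠ 0)
    (h : ∃ᶠ n in atTop, reflCoeff N ρ κ n = reflCoeff N ρ' κ' n) (k : Fin N) : ρ k = ρ' k := by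
  induction N with
  | zero => exact k.elim0
  | succ N ih =>
    have hr : ρ 0 = ρ' 0 := le_antisymm
      (not_lt.1 (not_radius_lt_of_frequently_reflCoeff_eq hρ' hanti' hκ' hρ hanti hκ (h0 0)
        (h.mono fun _ hn => hn.symm)))
      (not_lt.1 (not_radius_lt_of_frequently_reflCoeff_eq hρ hanti hκ hρ' hanti' hκ' (h0' 0) h))
    have hk : κ 0 = κ' 0 := tendsto_nhds_unique_of_frequently_eq
      (tendsto_reflCoeff_div hρ hanti hκ) (tendsto_reflCoeff_div hρ' hanti' hκ')
      (h.mono fun n hn => by rw [hn, hr])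
    refine Fin.cases hr (fun j => ih (ρ := Fin.tail ρ) (ρ' := Fin.tail ρ') (κ := Fin.tail κ)
      (κ' := Fin.tail κ') (fun k => hρ k.succ) (Fin.tail_strictAnti hanti) (fun k => hκ k.succ)
      (fun k => h0 k.succ) (fun k => hρ' k.succ) (Fin.tail_strictAnti hanti')
      (fun k => hκ' k.succ) (fun k => h0' k.succ) (h.mono fun n hn => ?_) j) k
    have hp : ρ' 0 ^ (2 * n) ≠ 0 := (pow_pos (hρ' 0) _).ne'
    have hy := abs_reflCoeff_tail_div_lt_one hρ hanti hκ n
    have hy' := abs_reflCoeff_tail_div_lt_one hρ' hanti' hκ' n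
    rw [reflCoeff, reflCoeff, hr, hk] at hn
    rw [hr] at hy
    have := moebius_injOn (hκ' 0) hy hy' (mul_left_cancel₀ hp hn)
    rwa [div_left_inj' hp] at this

/-- The transmission conditions for the order `n` in concentric layers, where `C k` and `D k` are
the amplitudes of `r ^ n` and `-r ^ (-n)` in the layer `k`, and no singular part is present in the
innermost one. They determine the outer amplitudes up to a factor. -/
theorem eq_neg_reflCoeff_mul {N : ℕ} {ρ : Fin N → ℝ} {σ : Fin (N + 1) → ℝ}
    (hρ : ∀ k, 0 < ρ k) (hanti : StrictAnti ρ) (hσ : ∀ k, 0 < σ k) (n : ℕ)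
    (C D : Fin (N + 1) → ℂ)
    (hcont : ∀ k : Fin N, C k.castSucc * (ρ k : ℂ) ^ n - D k.castSucc / (ρ k : ℂ) ^ n =
      C k.succ * (ρ k : ℂ) ^ n - D k.succ / (ρ k : ℂ) ^ n)
    (hflux : ∀ k : Fin N,
      (σ k.castSucc : ℂ) * (C k.castSucc * (ρ k : ℂ) ^ n + D k.castSucc / (ρ k : ℂ) ^ n) =
      σ k.succ * (C k.succ * (ρ k : ℂ) ^ n + D k.succ / (ρ k : ℂ) ^ n))
    (hlast : D (Fin.last N) = 0) :
    D 0 = -(reflCoeff N ρ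
      (fun k => (σ k.castSucc - σ k.succ) / (σ k.castSucc + σ k.succ)) n : ℝ) * C 0 := by
  induction N with
  | zero => simpa [reflCoeff] using hlast
  | succ N ih =>
    have hκ : ∀ k : Fin (N + 1),
        |(σ k.castSucc - σ k.succ) / (σ k.castSucc + σ k.succ)| < 1 := fun k => by
      have h1 := hσ k.castSucc
      have h2 := hσ k.succ
      rw [abs_div, abs_of_pos (add_pos h1 h2), div_lt_one (add_pos h1 h2), abs_lt]
      constructor <;> linarith
    have hy := abs_reflCoeff_tail_div_lt_one hρ hanti hκ n
    have ih' := ih (ρ := Fin.tail ρ) (σ := Fin.tail σ) (fun k => hρ k.succ)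
      (Fin.tail_strictAnti hanti) (fun k => hσ k.succ) (Fin.tail C) (Fin.tail D)
      (fun k => hcont k.succ) (fun k => hflux k.succ) hlast
    have e : (fun k : Fin N => (Fin.tail σ k.castSucc - Fin.tail σ k.succ) /
        (Fin.tail σ k.castSucc + Fin.tail σ k.succ)) = Fin.tail (fun k : Fin (N + 1) =>
          (σ k.castSucc - σ k.succ) / (σ k.castSucc + σ k.succ)) := rfl
    rw [e] at ih'
    rw [reflCoeff]
    have hden := one_add_mul_pos_of_abs_lt_one (hκ 0) hy
    generalize reflCoeff N (Fin.tail ρ) (Fin.tail (fun k : Fin (N + 1) =>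
          (σ k.castSucc - σ k.succ) / (σ k.castSucc + σ k.succ))) n = X at ih' hy hden ⊢
    have hc := hcont 0
    have hf := hflux 0
    have hs0 := hσ 0
    have hs1 := hσ 1
    have hP := pow_pos (hρ 0) n
    simp only [Fin.tail, Fin.castSucc_zero, Fin.succ_zero_eq_one] at ih' hc hf hden ⊢
    rw [mul_comm 2 n, pow_mul] at hden ⊢
    have hP' : (ρ 0 : ℂ) ^ n = ((ρ 0 ^ n : ℝ) : ℂ) := by push_cast; rfl
    rw [hP'] at hc hf
    rw [ih'] at hc hf
    generalize ρ 0 ^ n = P at hP hc hf hden ⊢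
    obtain ⟨y, rfl⟩ : ∃ y, X = y * P ^ 2 := ⟨X / P ^ 2, by field_simp⟩
    rw [mul_div_cancel_right₀ _ (pow_pos hP 2).ne'] at hden ⊢
    have hst := add_pos hs0 hs1
    have hΔ : 0 < σ 0 + σ 1 + (σ 0 - σ 1) * y := by
      have := mul_pos hst hden
      field_simp at this
      linarith
    have hrat : ((σ 0 - σ 1) / (σ 0 + σ 1) + y) / (1 + (σ 0 - σ 1) / (σ 0 + σ 1) * y) =
        (σ 0 - σ 1 + (σ 0 + σ 1) * y) / (σ 0 + σ 1 + (σ 0 - σ 1) * y) := by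
      rw [div_eq_div_iff hden.ne' hΔ.ne']
      field_simp
    have hPc : (P : ℂ) ≠ 0 := by exact_mod_cast hP.ne'
    have hΔc : (σ 0 + σ 1 + (σ 0 - σ 1) * y : ℂ) ≠ 0 := by exact_mod_cast hΔ.ne'
    rw [hrat]
    push_cast at hc hf ⊢
    field_simp at hc hf
    rw [← mul_div_assoc, ← neg_div, div_mul_eq_mul_div, eq_div_iff hΔc]
    linear_combination (1 + (y : ℂ)) * hf - (σ 1 : ℂ) * (1 - y) * hc

/-! ### Fourier coefficients on circles -/

/-- The `n`-th Fourier coefficient of `v` on the circle of radius `r` about `c`. -/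
noncomputable def circleCoeff (v : ℂ → ℂ) (c : ℂ) (n : ℤ) (r : ℝ) : ℂ :=
  (2 * Real.pi : ℂ)⁻¹ *
    ∫ θ in (0 : ℝ)..2 * Real.pi, Complex.exp (-(n * θ * Complex.I)) * v (circleMap c r θ)

lemma norm_exp_neg_int_mul (n : ℤ) (θ : ℝ) :
    ‖Complex.exp (-(n * θ * Complex.I))‖ = 1 := by
  rw [Complex.norm_exp]; simp

lemma norm_circleCoeff_le {v : ℂ → ℂ} {c : ℂ} {r M : ℝ} (n : ℤ)
    (h : ∀ θ : ℝ, ‖v (circleMap c r θ)‖ ≤ M) : ‖circleCoeff v c n r‖ ≤ M := by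
  have h1 := intervalIntegral.norm_integral_le_of_norm_le_const
    (f := fun θ : ℝ => Complex.exp (-(n * θ * Complex.I)) * v (circleMap c r θ))
    (a := 0) (b := 2 * Real.pi) (C := M)
    (fun θ _ => by rw [norm_mul, norm_exp_neg_int_mul, one_mul]; exact h θ)
  have hp := Real.two_pi_pos
  rw [sub_zero, abs_of_pos hp] at h1
  rw [circleCoeff, norm_mul, norm_inv]
  have h2 : ‖(2 * Real.pi : ℂ)‖ = 2 * Real.pi := by
    have : (2 * Real.pi : ℂ) = ((2 * Real.pi : ℝ) : ℂ) := by push_cast; rfl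
    rw [this, Complex.norm_real, Real.norm_of_nonneg hp.le]
  rw [h2, inv_mul_le_iff₀ hp]
  linarith

lemma circleCoeff_congr {v w : ℂ → ℂ} {c : ℂ} {r : ℝ} (n : ℤ)
    (h : ∀ θ : ℝ, v (circleMap c r θ) = w (circleMap c r θ)) :
    circleCoeff v c n r = circleCoeff w c n r := by
  simp only [circleCoeff, h]

lemma circleCoeff_const_mul (a : ℂ) (v : ℂ → ℂ) (c : ℂ) (n : ℤ) (r : ℝ) :
    circleCoeff (fun z => a * v z) c n r = a * circleCoeff v c n r := by
  simp only [circleCoeff]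
  rw [mul_left_comm, ← intervalIntegral.integral_const_mul a]
  simp only [mul_left_comm]

lemma circleCoeff_intervalIntegrable {v : ℂ → ℂ} {c : ℂ} {r : ℝ} (n : ℤ)
    (h : Continuous fun θ : ℝ => v (circleMap c r θ)) :
    IntervalIntegrable (fun θ : ℝ => Complex.exp (-(n * θ * Complex.I)) * v (circleMap c r θ))
      MeasureTheory.volume 0 (2 * Real.pi) :=
  (Continuous.mul (by fun_prop) h).intervalIntegrable _ _

lemma circleCoeff_add {v w : ℂ → ℂ} {c : ℂ} {r : ℝ} (n : ℤ)
    (hv : Continuous fun θ : ℝ => v (circleMap c r θ))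
    (hw : Continuous fun θ : ℝ => w (circleMap c r θ)) :
    circleCoeff (fun z => v z + w z) c n r = circleCoeff v c n r + circleCoeff w c n r := by
  simp only [circleCoeff]
  rw [← mul_add, ← intervalIntegral.integral_add (circleCoeff_intervalIntegrable n hv)
    (circleCoeff_intervalIntegrable n hw)]
  simp only [mul_add]

lemma circleCoeff_sub {v w : ℂ → ℂ} {c : ℂ} {r : ℝ} (n : ℤ)
    (hv : Continuous fun θ : ℝ => v (circleMap c r θ))
    (hw : Continuous fun θ : ℝ => w (circleMap c r θ)) :
    circleCoeff (fun z => v z - w z) c n r = circleCoeff v c n r - circleCoeff w c n r := by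
  simp only [circleCoeff]
  rw [← mul_sub, ← intervalIntegral.integral_sub (circleCoeff_intervalIntegrable n hv)
    (circleCoeff_intervalIntegrable n hw)]
  simp only [mul_sub]

lemma circleCoeff_conj (v : ℂ → ℂ) (c : ℂ) (n : ℤ) (r : ℝ) :
    circleCoeff (fun z => conj (v z)) c n r = conj (circleCoeff v c (-n) r) := by
  simp only [circleCoeff, intervalIntegral, map_mul, map_inv₀, map_sub, ← integral_conj]
  simp [← Complex.exp_conj, map_ofNat]

lemma circleCoeff_eq_circleIntegral (v : ℂ → ℂ) (c : ℂ) (n : ℤ) {r : ℝ} (hr : r ≠ 0) :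
    circleCoeff v c n r = (2 * Real.pi * Complex.I : ℂ)⁻¹ *
      (r : ℂ) ^ n * ∮ z in C(c, r), (z - c) ^ (-n - 1) * v z := by
  have hr' : (r : ℂ) ≠ 0 := by exact_mod_cast hr
  rw [circleIntegral, circleCoeff]
  have h : ∀ θ : ℝ, deriv (circleMap c r) θ •
      ((circleMap c r θ - c) ^ (-n - 1) * v (circleMap c r θ)) =
      (Complex.I * ((r : ℂ) ^ n)⁻¹) *
        (Complex.exp (-(n * θ * Complex.I)) * v (circleMap c r θ)) := fun θ => by
    have hexp : Complex.exp (-(n * θ * Complex.I)) = (Complex.exp (θ * Complex.I)) ^ (-n) := by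
      rw [← Complex.exp_int_mul]; push_cast; ring_nf
    rw [deriv_circleMap, smul_eq_mul, hexp, circleMap_sub_center, circleMap_zero,
      zpow_sub_one₀ (mul_ne_zero hr' (Complex.exp_ne_zero _)), mul_zpow, zpow_neg (r : ℂ)]
    have := Complex.exp_ne_zero (θ * Complex.I)
    field_simp
  simp only [h]
  rw [intervalIntegral.integral_const_mul]
  have := Complex.I_ne_zero
  have hz : (r : ℂ) ^ n ≠ 0 := zpow_ne_zero _ hr'
  generalize (∫ θ in (0 : ℝ)..2 * Real.pi, _ : ℂ) = S
  field_simp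

/-- On an annulus, the `n`-th Fourier coefficient of a holomorphic function is a multiple of
`r ^ n`. -/
lemma exists_circleCoeff_eq_zpow {h : ℂ → ℂ} {c : ℂ} {J : Set ℝ} (hJ : J.OrdConnected)
    (hpos : ∀ r ∈ J, 0 < r) (hd : ∀ z, dist z c ∈ J → DifferentiableAt ℂ h z) (n : ℤ) :
    ∃ C : ℂ, ∀ r ∈ J, circleCoeff h c n r = C * (r : ℂ) ^ n := by
  rcases J.eq_empty_or_nonempty with rfl | ⟨r₀, hr₀⟩
  · exact ⟨0, by simp⟩
  have key : ∀ r ∈ J, ∀ s ∈ J, r ≤ s → (∮ z in C(c, s), (z - c) ^ (-n - 1) * h z) =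
      ∮ z in C(c, r), (z - c) ^ (-n - 1) * h z := fun r hr s hs hrs => by
    have hdiff : ∀ z ∈ Metric.closedBall c s \ Metric.ball c r,
        DifferentiableAt ℂ (fun z => (z - c) ^ (-n - 1) * h z) z := fun z hz => by
      have hz' : r ≤ dist z c := not_lt.1 hz.2
      have hne : z - c ≠ 0 := fun h0 => by
        rw [sub_eq_zero.1 h0, dist_self] at hz'
        exact absurd (hpos r hr) (not_lt.2 hz')
      exact (DifferentiableAt.zpow (f := fun z => z - c) (by fun_prop) (Or.inl hne)).mul
        (hd z (hJ.out hr hs ⟨hz', hz.1⟩))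
    exact Complex.circleIntegral_eq_of_differentiable_on_annulus_off_countable (hpos r hr) hrs
      Set.countable_empty (fun z hz => (hdiff z hz).continuousAt.continuousWithinAt)
      (fun z hz => hdiff z ⟨Metric.ball_subset_closedBall hz.1.1,
        fun hb => hz.1.2 (Metric.ball_subset_closedBall hb)⟩)
  refine ⟨(2 * Real.pi * Complex.I : ℂ)⁻¹ * ∮ z in C(c, r₀), (z - c) ^ (-n - 1) * h z,
    fun r hr => ?_⟩
  rw [circleCoeff_eq_circleIntegral h c n (hpos r hr).ne', mul_right_comm]
  rcases le_total r r₀ with hle | hle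
  · rw [key r hr r₀ hr₀ hle]
  · rw [key r₀ hr₀ r hr hle]

/-- The Wirtinger derivative `∂u/∂z`. -/
noncomputable def wirtinger (u : ℂ → ℂ) (z : ℂ) : ℂ :=
  (fderiv ℝ u z 1 - Complex.I * fderiv ℝ u z Complex.I) / 2

/-- The conjugate Wirtinger derivative `∂u/∂z̄`. -/
noncomputable def wirtingerBar (u : ℂ → ℂ) (z : ℂ) : ℂ :=
  (fderiv ℝ u z 1 + Complex.I * fderiv ℝ u z Complex.I) / 2

lemma fderiv_eq_wirtinger (u : ℂ → ℂ) (z v : ℂ) :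
    fderiv ℝ u z v = v * wirtinger u z + conj v * wirtingerBar u z := by
  have h : fderiv ℝ u z v = v.re * fderiv ℝ u z 1 + v.im * fderiv ℝ u z Complex.I := by
    conv_lhs => rw [show v = v.re • (1 : ℂ) + v.im • Complex.I by simp]
    rw [map_add, map_smul, map_smul, Complex.real_smul, Complex.real_smul]
  have h1 : v = v.re + v.im * Complex.I := (Complex.re_add_im v).symm
  have h2 : conj v = v.re - v.im * Complex.I := by
    apply Complex.ext <;> simp
  rw [h, h2, wirtinger, wirtingerBar]
  nth_rw 3 [h1]
  linear_combination ((v.im : ℂ) * fderiv ℝ u z Complex.I) * Complex.I_sq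

lemma wirtingerBar_eq_conj {u : ℂ → ℂ} {z : ℂ} :
    wirtingerBar u z = conj (wirtinger (fun z => conj (u z)) z) := by
  have h : fderiv ℝ (fun z => conj (u z)) z =
      (Complex.conjCLE : ℂ →L[ℝ] ℂ).comp (fderiv ℝ u z) :=
    Complex.conjCLE.comp_fderiv (f := u) (x := z)
  simp [wirtingerBar, wirtinger, h, map_ofNat]

lemma differentiableAt_wirtinger {u : ℂ → ℂ} {z : ℂ} (hu : InnerProductSpace.HarmonicAt u z) :
    DifferentiableAt ℂ (wirtinger u) z := by
  have h1 := hu.1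
  have h2 : wirtinger u = (fun z => (2⁻¹ : ℂ) • ((fderiv ℝ u z 1) -
      Complex.I • (fderiv ℝ u z Complex.I))) := by
    ext; simp [wirtinger]; ring
  rw [h2]
  refine DifferentiableAt.const_smul (𝕜 := ℂ) (R := ℂ) ?_ _
  have d1 : DifferentiableAt ℝ (fun z => fderiv ℝ u z 1) z := by fun_prop
  have dI : DifferentiableAt ℝ (fun z => fderiv ℝ u z Complex.I) z := by fun_prop
  have dI' : DifferentiableAt ℝ (fun z => Complex.I • fderiv ℝ u z Complex.I) z := by fun_prop
  refine differentiableAt_complex_iff_differentiableAt_real.2 ⟨d1.sub dI', ?_⟩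
  rw [fderiv_fun_sub d1 dI', fderiv_fun_const_smul dI]
  rw [fderiv_clm_apply (by fun_prop) (by fun_prop), fderiv_clm_apply (by fun_prop) (by fun_prop)]
  have h3 := hu.2.eq_of_nhds
  simp only [InnerProductSpace.laplacian_eq_iteratedFDeriv_complexPlane, iteratedFDeriv_two_apply,
    Fin.isValue, Matrix.cons_val_zero, Matrix.cons_val_one, Matrix.cons_val_fin_one,
    Pi.zero_apply, add_eq_zero_iff_eq_neg] at h3
  have h4 : fderiv ℝ (fderiv ℝ u) z 1 Complex.I = fderiv ℝ (fderiv ℝ u) z Complex.I 1 :=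
    h1.isSymmSndFDerivAt (by simp) 1 Complex.I
  simp [h3, h4, mul_sub, ← mul_assoc]
  ring

lemma harmonicAt_conj {u : ℂ → ℂ} {z : ℂ} (hu : InnerProductSpace.HarmonicAt u z) :
    InnerProductSpace.HarmonicAt (fun z => conj (u z)) z :=
  hu.comp_CLM (Complex.conjCLE : ℂ →L[ℝ] ℂ)

lemma continuous_wirtinger_circleMap {u : ℂ → ℂ} {c : ℂ} {r : ℝ}
    (hu : ∀ θ : ℝ, ContDiffAt ℝ 2 u (circleMap c r θ)) :
    (Continuous fun θ : ℝ => (circleMap c r θ - c) * wirtinger u (circleMap c r θ)) ∧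
    Continuous fun θ : ℝ => conj (circleMap c r θ - c) * wirtingerBar u (circleMap c r θ) := by
  have h : ∀ v : ℂ, Continuous fun θ : ℝ => fderiv ℝ u (circleMap c r θ) v := fun v => by
    refine continuous_iff_continuousAt.2 fun θ => ?_
    have h1 : ContinuousAt (fderiv ℝ u) (circleMap c r θ) :=
      ((hu θ).fderiv_right (m := 1) (by norm_num)).continuousAt
    exact (h1.clm_apply continuousAt_const).comp (f := circleMap c r)
      (continuous_circleMap c r).continuousAt
  have h1 := h 1
  have hI := h Complex.I
  constructor
  · simp only [wirtinger]; fun_prop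
  · simp only [wirtingerBar]; fun_prop

/-- Differentiation in the angle multiplies the `n`-th Fourier coefficient by `i n`. -/
lemma int_mul_circleCoeff {u : ℂ → ℂ} {c : ℂ} {r : ℝ}
    (hu : ∀ θ : ℝ, ContDiffAt ℝ 2 u (circleMap c r θ)) (n : ℤ) :
    n * circleCoeff u c n r = circleCoeff (fun z => (z - c) * wirtinger u z) c n r -
      circleCoeff (fun z => conj (z - c) * wirtingerBar u z) c n r := by
  obtain ⟨hc1, hc2⟩ := continuous_wirtinger_circleMap hu
  rw [← circleCoeff_sub n hc1 hc2]
  set g : ℝ → ℂ := fun θ => (circleMap c r θ - c) * wirtinger u (circleMap c r θ) -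
    conj (circleMap c r θ - c) * wirtingerBar u (circleMap c r θ) with hg
  have hgc : Continuous g := hc1.sub hc2
  have hderiv : ∀ θ : ℝ, HasDerivAt (fun θ => u (circleMap c r θ)) (Complex.I * g θ) θ := fun θ => by
    have h := ((hu θ).differentiableAt (by norm_num)).hasFDerivAt.comp_hasDerivAt θ
      (hasDerivAt_circleMap c r θ)
    refine h.congr_deriv ?_
    rw [fderiv_eq_wirtinger, hg]
    simp only [circleMap_sub_center, map_mul, Complex.conj_I]
    ring
  have hexp : ∀ θ : ℝ, HasDerivAt (fun θ : ℝ => Complex.exp (-(n * θ * Complex.I)))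
      (-(n * Complex.I) * Complex.exp (-(n * θ * Complex.I))) θ := fun θ => by
    have h : HasDerivAt (fun θ : ℝ => -(n * (θ : ℂ) * Complex.I)) (-(n * 1 * Complex.I)) θ :=
      ((Complex.ofRealCLM.hasDerivAt (x := θ)).const_mul (n : ℂ) |>.mul_const Complex.I).neg
    refine h.cexp.congr_deriv ?_
    ring
  have hparts := intervalIntegral.integral_mul_deriv_eq_deriv_mul (a := 0) (b := 2 * Real.pi)
    (fun θ _ => hexp θ) (fun θ _ => hderiv θ)
    (Continuous.intervalIntegrable (by fun_prop) _ _)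
    (Continuous.intervalIntegrable (by fun_prop) _ _)
  have hper : Complex.exp (-(n * ((2 * Real.pi : ℝ) : ℂ) * Complex.I)) = 1 := by
    rw [Complex.exp_eq_one_iff]
    exact ⟨-n, by push_cast; ring⟩
  have hper' : circleMap c r (2 * Real.pi) = circleMap c r 0 := by simp [circleMap]
  rw [hper, hper'] at hparts
  simp only [Complex.ofReal_zero, mul_zero, zero_mul, neg_zero, Complex.exp_zero, sub_self,
    zero_sub] at hparts
  have e1 : ∀ θ : ℝ, Complex.exp (-(n * θ * Complex.I)) * (Complex.I * g θ) =
    Complex.I * (Complex.exp (-(n * θ * Complex.I)) * g θ) := fun θ => by ring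
  have e2 : ∀ θ : ℝ, -(n * Complex.I) * Complex.exp (-(n * θ * Complex.I)) * u (circleMap c r θ) =
    -(n * Complex.I) * (Complex.exp (-(n * θ * Complex.I)) * u (circleMap c r θ)) :=
      fun θ => by ring
  simp only [e1, e2, intervalIntegral.integral_const_mul] at hparts
  have hparts' := mul_left_cancel₀ (b := ∫ θ in (0 : ℝ)..2 * Real.pi,
    Complex.exp (-(n * θ * Complex.I)) * g θ) (c := n * ∫ θ in (0 : ℝ)..2 * Real.pi,
    Complex.exp (-(n * θ * Complex.I)) * u (circleMap c r θ)) Complex.I_ne_zero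
    (by rw [hparts]; ring)
  rw [circleCoeff, circleCoeff, hparts']
  ring

lemma mul_circleCoeff_normalDeriv {N : ℕ} (D : LayeredDisk N) {u : ℂ → ℂ} {r : ℝ} (hr : 0 < r)
    (hu : ∀ θ : ℝ, ContDiffAt ℝ 2 u (circleMap D.center r θ)) (n : ℤ) :
    r * circleCoeff (D.normalDeriv u) D.center n r =
      circleCoeff (fun z => (z - D.center) * wirtinger u z) D.center n r +
      circleCoeff (fun z => conj (z - D.center) * wirtingerBar u z) D.center n r := by
  obtain ⟨hc1, hc2⟩ := continuous_wirtinger_circleMap hu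
  rw [← circleCoeff_add n hc1 hc2, ← circleCoeff_const_mul]
  refine circleCoeff_congr n fun θ => ?_
  have hr' : (r : ℂ) ≠ 0 := by exact_mod_cast hr.ne'
  rw [LayeredDisk.normalDeriv, map_smul, fderiv_eq_wirtinger, circleMap_sub_center,
    norm_circleMap_zero, abs_of_pos hr, Complex.real_smul, Complex.ofReal_inv,
    mul_inv_cancel_left₀ hr']

lemma continuous_normalDeriv_circleMap {N : ℕ} (D : LayeredDisk N) {u : ℂ → ℂ} {r : ℝ}
    (hu : ∀ θ : ℝ, ContDiffAt ℝ 2 u (circleMap D.center r θ)) :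
    Continuous fun θ : ℝ => D.normalDeriv u (circleMap D.center r θ) := by
  obtain ⟨hc1, hc2⟩ := continuous_wirtinger_circleMap hu
  have h : (fun θ : ℝ => D.normalDeriv u (circleMap D.center r θ)) = fun θ : ℝ =>
      ((|r|⁻¹ : ℝ) : ℂ) *
      ((circleMap D.center r θ - D.center) * wirtinger u (circleMap D.center r θ) +
      conj (circleMap D.center r θ - D.center) * wirtingerBar u (circleMap D.center r θ)) := by
    ext1 θ
    rw [LayeredDisk.normalDeriv, map_smul, fderiv_eq_wirtinger, circleMap_sub_center,
      norm_circleMap_zero, Complex.real_smul]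
  rw [h]
  exact continuous_const.mul (hc1.add hc2)

/-- Fourier coefficients of a function with limits at every point of a circle converge to those of
the boundary values: the compactness of the circle makes the function bounded nearby, so that
dominated convergence applies. -/
lemma tendsto_circleCoeff {L : Set ℂ} {v d : ℂ → ℂ} {c : ℂ} {ρ : ℝ} {s : Set ℝ} (n : ℤ)
    (hcont : ∀ᶠ r in 𝓝[s] ρ, Continuous fun θ : ℝ => v (circleMap c r θ))
    (hL : ∀ᶠ r in 𝓝[s] ρ, ∀ θ : ℝ, circleMap c r θ ∈ L)
    (hd : ∀ θ : ℝ, Tendsto v (𝓝[L] (circleMap c ρ θ)) (𝓝 (d (circleMap c ρ θ)))) :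
    Tendsto (circleCoeff v c n) (𝓝[s] ρ) (𝓝 (circleCoeff d c n ρ)) := by
  have hcm : Continuous fun p : ℝ × ℝ => circleMap c p.1 p.2 := by
    unfold circleMap; fun_prop
  obtain ⟨M, hM⟩ : ∃ M : ℝ, ∀ᶠ r in 𝓝 ρ, ∀ θ ∈ Set.Icc 0 (2 * Real.pi),
      circleMap c r θ ∈ L → ‖v (circleMap c r θ)‖ ≤ M := by
    refine (isCompact_Icc (a := (0 : ℝ)) (b := 2 * Real.pi)).induction_on
      (p := fun t => ∃ M : ℝ, ∀ᶠ r in 𝓝 ρ, ∀ θ ∈ t,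
        circleMap c r θ ∈ L → ‖v (circleMap c r θ)‖ ≤ M) ⟨0, by simp⟩ ?_ ?_ ?_
    · rintro t t' htt' ⟨M, hM⟩
      exact ⟨M, hM.mono fun r hr θ hθ => hr θ (htt' hθ)⟩
    · rintro t t' ⟨M, hM⟩ ⟨M', hM'⟩
      refine ⟨max M M', ?_⟩
      filter_upwards [hM, hM'] with r hr hr' θ hθ hmem
      rcases hθ with hθ | hθ
      · exact (hr θ hθ hmem).trans (le_max_left _ _)
      · exact (hr' θ hθ hmem).trans (le_max_right _ _)
    · intro θ _
      have h1 : ∀ᶠ z in 𝓝 (circleMap c ρ θ), z ∈ L →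
          ‖v z‖ ≤ ‖d (circleMap c ρ θ)‖ + 1 := by
        rw [← eventually_nhdsWithin_iff]
        exact ((hd θ).norm.eventually (gt_mem_nhds (lt_add_one _))).mono fun _ h => h.le
      have h2 := (hcm.tendsto (ρ, θ)).eventually h1
      rw [nhds_prod_eq, eventually_prod_iff] at h2
      obtain ⟨pa, ha, pb, hb, hab⟩ := h2
      exact ⟨{θ | pb θ}, mem_nhdsWithin_of_mem_nhds hb, _,
        ha.mono fun r hr θ' hθ' => hab hr hθ'⟩
  refine Tendsto.const_mul _ (intervalIntegral.tendsto_integral_filter_of_dominated_convergence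
    (fun _ => M) ?_ ?_ (by simp) ?_)
  · filter_upwards [hcont] with r hr
    exact (Continuous.mul (by fun_prop) hr).aestronglyMeasurable
  · filter_upwards [hL, mem_nhdsWithin_of_mem_nhds hM] with r hr hr'
    refine Eventually.of_forall fun θ hθ => ?_
    rw [Set.uIoc_of_le Real.two_pi_pos.le] at hθ
    rw [norm_mul, norm_exp_neg_int_mul, one_mul]
    exact hr' θ (Set.Ioc_subset_Icc_self hθ) (hr θ)
  · refine Eventually.of_forall fun θ _ => Tendsto.const_mul _ ((hd θ).comp ?_)
    refine tendsto_nhdsWithin_iff.2 ⟨?_, hL.mono fun r hr => hr θ⟩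
    exact ((hcm.comp (Continuous.prodMk_left θ)).tendsto ρ).mono_left nhdsWithin_le_nhds

/-- A continuous function on a circle is the sum of its Fourier series, if the latter converges
absolutely. -/
lemma hasSum_circleCoeff {v : ℂ → ℂ} {c : ℂ} {r : ℝ}
    (hv : Continuous fun θ : ℝ => v (circleMap c r θ))
    (hs : Summable fun n : ℤ => circleCoeff v c n r) (θ : ℝ) :
    HasSum (fun n : ℤ => circleCoeff v c n r * Complex.exp (n * θ * Complex.I))
      (v (circleMap c r θ)) := by
  have : Fact (0 < 2 * Real.pi) := ⟨Real.two_pi_pos⟩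
  have hper : Function.Periodic (fun θ : ℝ => v (circleMap c r θ)) (2 * Real.pi) := fun θ => by
    simp only [periodic_circleMap c r θ]
  let f : C(AddCircle (2 * Real.pi), ℂ) := ⟨hper.lift, continuous_coinduced_dom.2 hv⟩
  have hf : ∀ x : ℝ, f x = v (circleMap c r x) := fun x => rfl
  have hcoeff : ∀ n : ℤ, fourierCoeff f n = circleCoeff v c n r := fun n => by
    rw [fourierCoeff_eq_intervalIntegral f n 0, circleCoeff, zero_add, Complex.real_smul]
    congr 1
    · push_cast; rw [one_div]
    · refine intervalIntegral.integral_congr fun x _ => ?_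
      simp only [hf, smul_eq_mul, fourier_coe_apply]
      congr 2
      have : (Real.pi : ℂ) ≠ 0 := by exact_mod_cast Real.pi_ne_zero
      push_cast
      field_simp
  have h := has_pointwise_sum_fourier_series_of_summable (f := f)
    (by rw [show fourierCoeff f = _ from funext hcoeff]; exact hs) (θ : AddCircle (2 * Real.pi))
  rw [hf] at h
  convert h using 2 with n
  rw [hcoeff, smul_eq_mul, fourier_coe_apply]
  congr 2
  have : (Real.pi : ℂ) ≠ 0 := by exact_mod_cast Real.pi_ne_zero
  push_cast
  field_simp

/-! ### Taylor coefficients and the layers -/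

lemma dist_circleMap_center {c : ℂ} {r : ℝ} (hr : 0 < r) (θ : ℝ) : dist (circleMap c r θ) c = r := by
  rw [Complex.dist_eq, circleMap_sub_center, norm_circleMap_zero, abs_of_pos hr]

lemma exists_circleMap_eq (c z : ℂ) : ∃ θ : ℝ, z = circleMap c (dist z c) θ := by
  refine ⟨(z - c).arg, ?_⟩
  rw [circleMap, Complex.dist_eq, Complex.norm_mul_exp_arg_mul_I]
  ring

lemma tendsto_ofReal_zpow_nhdsGT_zero {n : ℤ} (hn : 0 < n) :
    Tendsto (fun r : ℝ => (r : ℂ) ^ n) (𝓝[>] 0) (𝓝 0) := by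
  have h : ContinuousAt (fun r : ℝ => (r : ℂ) ^ n) 0 :=
    ContinuousAt.zpow₀ (by fun_prop) n (Or.inr hn.le)
  have h' := h.tendsto
  rw [Complex.ofReal_zero, zero_zpow n hn.ne'] at h'
  exact h'.mono_left nhdsWithin_le_nhds

lemma tendsto_ofReal_zpow_neg_atTop {n : ℤ} (hn : 0 < n) :
    Tendsto (fun r : ℝ => (r : ℂ) ^ (-n)) atTop (𝓝 0) := by
  rw [tendsto_zero_iff_norm_tendsto_zero]
  have h := tendsto_pow_neg_atTop (𝕜 := ℝ) (n := n.toNat) (by omega)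
  refine h.congr' ?_
  filter_upwards [eventually_gt_atTop 0] with r hr
  rw [norm_zpow, Complex.norm_real, Real.norm_of_nonneg hr.le, Int.toNat_of_nonneg hn.le]

/-- An amplitude `a` with `a r ^ n → 0` as `r → ∞` and `n ≥ 0` vanishes. -/
lemma eq_zero_of_tendsto_mul_zpow_atTop {a : ℂ} {n : ℤ} (hn : 0 ≤ n)
    (h : Tendsto (fun r : ℝ => a * (r : ℂ) ^ n) atTop (𝓝 0)) : a = 0 := by
  rcases hn.eq_or_lt with rfl | hn
  · simpa using tendsto_nhds_unique tendsto_const_nhds (h.congr fun r => by simp)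
  have h2 := h.mul (tendsto_ofReal_zpow_neg_atTop hn)
  rw [zero_mul] at h2
  refine tendsto_nhds_unique (tendsto_const_nhds.congr' ?_) h2
  filter_upwards [eventually_gt_atTop 0] with r hr
  have hr' : (r : ℂ) ≠ 0 := by exact_mod_cast hr.ne'
  rw [zpow_neg, mul_assoc, mul_inv_cancel₀ (zpow_ne_zero _ hr'), mul_one]

/-- An amplitude `a` with `a r ^ (-n) → 0` as `r → 0` and `n ≥ 0` vanishes. -/
lemma eq_zero_of_tendsto_mul_zpow_nhdsGT {a : ℂ} {n : ℤ} (hn : 0 ≤ n)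
    (h : Tendsto (fun r : ℝ => a * (r : ℂ) ^ (-n)) (𝓝[>] 0) (𝓝 0)) : a = 0 := by
  rcases hn.eq_or_lt with rfl | hn
  · simpa using tendsto_nhds_unique tendsto_const_nhds (h.congr fun r => by simp)
  have h2 := h.mul (tendsto_ofReal_zpow_nhdsGT_zero hn)
  rw [zero_mul] at h2
  refine tendsto_nhds_unique (tendsto_const_nhds.congr' ?_) h2
  filter_upwards [self_mem_nhdsWithin] with r hr
  have hr' : (r : ℂ) ≠ 0 := by exact_mod_cast (ne_of_gt hr)
  rw [zpow_neg, mul_assoc, inv_mul_cancel₀ (zpow_ne_zero _ hr'), mul_one]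

lemma tendsto_circleCoeff_atTop {v : ℂ → ℂ} (hv : Tendsto v (cocompact ℂ) (𝓝 0)) (c : ℂ) (n : ℤ) :
    Tendsto (circleCoeff v c n) atTop (𝓝 0) := by
  rw [Metric.tendsto_nhds]
  intro ε hε
  have h1 := (Metric.tendsto_nhds.1 hv) (ε / 2) (half_pos hε)
  rw [← Metric.cobounded_eq_cocompact, ← comap_norm_atTop, eventually_comap] at h1
  obtain ⟨R, hR⟩ := eventually_atTop.1 h1
  filter_upwards [eventually_ge_atTop (R + ‖c‖), eventually_gt_atTop 0] with r hr hr0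
  rw [dist_zero_right]
  refine (norm_circleCoeff_le n (M := ε / 2) fun θ => ?_).trans_lt (half_lt_self hε)
  have h2 : r ≤ ‖circleMap c r θ‖ + ‖c‖ := by
    have h3 := dist_circleMap_center (c := c) hr0 θ
    rw [dist_eq_norm] at h3
    exact h3.symm.le.trans (norm_sub_le _ _)
  simpa using (hR _ (by linarith) _ rfl).le

lemma tendsto_circleCoeff_nhdsGT_zero {v : ℂ → ℂ} {c : ℂ} (hv : ContinuousAt v c) (h0 : v c = 0)
    (n : ℤ) : Tendsto (circleCoeff v c n) (𝓝[>] 0) (𝓝 0) := by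
  rw [Metric.tendsto_nhds]
  intro ε hε
  obtain ⟨δ, hδ, h⟩ := Metric.continuousAt_iff.1 hv (ε / 2) (half_pos hε)
  filter_upwards [Ioo_mem_nhdsGT hδ] with r hr
  rw [dist_zero_right]
  refine (norm_circleCoeff_le n (M := ε / 2) fun θ => ?_).trans_lt (half_lt_self hε)
  have h1 := h (x := circleMap c r θ) (by rw [dist_circleMap_center hr.1]; exact hr.2)
  rw [h0, dist_zero_right] at h1
  exact h1.le

lemma wirtingerBar_eq_zero {h : ℂ → ℂ} {z : ℂ} (hd : DifferentiableAt ℂ h z) :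
    wirtingerBar h z = 0 := by
  rw [wirtingerBar, (differentiableAt_complex_iff_differentiableAt_real.1 hd).2, smul_eq_mul,
    ← mul_assoc, Complex.I_mul_I]
  ring

lemma differentiableAt_of_wirtingerBar_eq_zero {h : ℂ → ℂ} {z : ℂ} (hd : DifferentiableAt ℝ h z)
    (h0 : wirtingerBar h z = 0) : DifferentiableAt ℂ h z := by
  refine differentiableAt_complex_iff_differentiableAt_real.2 ⟨hd, ?_⟩
  rw [fderiv_eq_wirtinger h z Complex.I, fderiv_eq_wirtinger h z 1, h0]
  simp

lemma Differentiable.contDiffAt_real {H : ℂ → ℂ} (hH : Differentiable ℂ H) (z : ℂ) :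
    ContDiffAt ℝ 2 H z :=
  (hH.contDiff (n := 2)).contDiffAt.restrict_scalars ℝ

lemma hasSum_int_of_nat {f : ℤ → ℂ} {a : ℂ} (hf : ∀ n < 0, f n = 0) :
    HasSum (fun n : ℕ => f n) a ↔ HasSum f a := by
  refine Function.Injective.hasSum_iff Nat.cast_injective fun n hn => hf n ?_
  by_contra h
  exact hn ⟨n.toNat, Int.toNat_of_nonneg (not_lt.1 h)⟩

/-- The Taylor expansion of an entire function about `c`, with the coefficients read off from
circles about `c`. -/
theorem exists_taylor_circleCoeff {H : ℂ → ℂ} (hH : Differentiable ℂ H) (c : ℂ) :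
    ∃ b : ℕ → ℂ, (∀ T : ℝ, 0 < T → Summable fun n => ‖b n‖ * T ^ n) ∧
      (∀ z, z ≠ c → HasSum (fun n => b n * (z - c) ^ n) (H z)) ∧
      (∀ r : ℝ, 0 < r → ∀ n : ℕ, circleCoeff H c n r = b n * (r : ℂ) ^ n) ∧
      (∀ r : ℝ, 0 < r → ∀ n : ℤ, n < 0 → circleCoeff H c n r = 0) := by
  choose B hB using fun n : ℤ => exists_circleCoeff_eq_zpow (h := H) (c := c)
    (Set.ordConnected_Ioi (a := (0 : ℝ))) (fun r hr => hr) (fun z _ => hH z) n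
  have hneg : ∀ n : ℤ, n < 0 → B n = 0 := fun n hn => by
    have hz : n * B n = 0 := by
      refine eq_zero_of_tendsto_mul_zpow_nhdsGT (n := -n) (by omega) ?_
      have hw := (differentiableAt_wirtinger (hH.analyticAt c).harmonicAt).continuousAt
      refine (tendsto_circleCoeff_nhdsGT_zero (v := fun z => (z - c) * wirtinger H z) (c := c)
        (ContinuousAt.mul (by fun_prop) hw) (by simp) n).congr' ?_
      filter_upwards [self_mem_nhdsWithin] with r hr
      rw [neg_neg, mul_assoc, ← hB n r hr, int_mul_circleCoeff (fun θ => hH.contDiffAt_real _) n,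
        circleCoeff_congr (v := fun z => conj (z - c) * wirtingerBar H z) (w := fun _ => 0) n
          fun θ => by rw [wirtingerBar_eq_zero (hH _), mul_zero]]
      simp [circleCoeff]
    exact (mul_eq_zero.1 hz).resolve_left (by exact_mod_cast hn.ne)
  have hsum : ∀ T : ℝ, 0 < T → Summable fun n : ℕ => ‖B n‖ * T ^ n := fun T hT => by
    obtain ⟨M, hM⟩ := (isCompact_sphere c (2 * T)).exists_bound_of_continuousOn
      hH.continuous.continuousOn
    refine Summable.of_nonneg_of_le (fun n => by positivity) (fun n => ?_)
      ((summable_geometric_of_lt_one (r := (1 / 2 : ℝ)) (by norm_num) (by norm_num)).mul_left M)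
    have h1 := norm_circleCoeff_le (v := H) (c := c) (r := 2 * T) (M := M) n fun θ =>
      hM _ (circleMap_mem_sphere c (by positivity) θ)
    have h2T : (0 : ℝ) < 2 * T := by positivity
    rw [hB n (2 * T) h2T, norm_mul, norm_zpow, Complex.norm_real, Real.norm_of_nonneg h2T.le,
      zpow_natCast, mul_pow] at h1
    rw [one_div, inv_pow, ← div_eq_mul_inv, le_div_iff₀ (by positivity)]
    linarith
  refine ⟨fun n => B n, hsum, fun z hz => ?_, fun r hr n => by rw [hB n r hr, zpow_natCast],
    fun r hr n hn => by rw [hB n r hr, hneg n hn, zero_mul]⟩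
  obtain ⟨θ, hθ⟩ := exists_circleMap_eq c z
  have hr : 0 < dist z c := dist_pos.2 hz
  set r := dist z c
  have hzero : ∀ n < 0, circleCoeff H c n r = 0 := fun n hn => by
    rw [hB n r hr, hneg n hn, zero_mul]
  have hs : Summable fun n : ℤ => circleCoeff H c n r := by
    obtain ⟨a, ha⟩ : Summable fun n : ℕ => circleCoeff H c n r := by
      refine Summable.of_norm ((hsum r hr).congr fun n => ?_)
      rw [hB n r hr, norm_mul, norm_zpow, Complex.norm_real, Real.norm_of_nonneg hr.le,
        zpow_natCast]
    exact ⟨a, (hasSum_int_of_nat hzero).1 ha⟩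
  have h := hasSum_circleCoeff (v := H) (c := c) (r := r)
    (hH.continuous.comp (continuous_circleMap c r)) hs θ
  rw [← hθ, ← hasSum_int_of_nat (fun n hn => by rw [hzero n hn, zero_mul])] at h
  refine h.congr_fun fun n => ?_
  have hzc : z - c = circleMap 0 r θ :=
    (congrArg (· - c) hθ).trans (circleMap_sub_center c r θ)
  rw [hB n r hr, hzc, circleMap_zero, mul_pow, ← Complex.exp_nat_mul,
    zpow_natCast, mul_assoc, Int.cast_natCast, mul_assoc]

namespace LayeredDisk

variable {N : ℕ}

/-- The radii of the circles about the centre that lie in the `k`-th layer. -/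
def layerRadii (D : LayeredDisk N) (k : Fin (N + 1)) : Set ℝ :=
  {r | 0 < r ∧ (∀ i : Fin N, k ≤ i.castSucc → D.radius i < r) ∧
       (∀ i : Fin N, i.castSucc < k → r < D.radius i)}

lemma mem_layer_of_dist_mem (D : LayeredDisk N) {k : Fin (N + 1)} {z : ℂ}
    (h : dist z D.center ∈ D.layerRadii k) : z ∈ D.layer k := h.2

lemma circleMap_mem_layer (D : LayeredDisk N) {k : Fin (N + 1)} {r : ℝ}
    (h : r ∈ D.layerRadii k) (θ : ℝ) : circleMap D.center r θ ∈ D.layer k :=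
  D.mem_layer_of_dist_mem (by rwa [dist_circleMap_center h.1])

lemma ordConnected_layerRadii (D : LayeredDisk N) (k : Fin (N + 1)) :
    (D.layerRadii k).OrdConnected :=
  ⟨fun _ hr _ hs _ ht => ⟨hr.1.trans_le ht.1, fun i hi => (hr.2.1 i hi).trans_le ht.1,
    fun i hi => ht.2.trans_lt (hs.2.2 i hi)⟩⟩

lemma eventually_mem_layerRadii_outside (D : LayeredDisk N) (k : Fin N) :
    ∀ᶠ r in 𝓝[>] (D.radius k), r ∈ D.layerRadii k.castSucc := by
  have h1 : ∀ᶠ r in 𝓝[>] (D.radius k), ∀ i : Fin N, i < k → r < D.radius i := by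
    refine eventually_all.2 fun i => ?_
    by_cases hi : i < k
    · filter_upwards [mem_nhdsWithin_of_mem_nhds (gt_mem_nhds (D.radius_strictAnti hi))] with r hr _
      exact hr
    · exact Eventually.of_forall fun r h => absurd h hi
  filter_upwards [h1, self_mem_nhdsWithin] with r hr hr'
  exact ⟨(D.radius_pos k).trans hr', fun i hi =>
    (D.radius_strictAnti.antitone (Fin.castSucc_le_castSucc_iff.1 hi)).trans_lt hr',
    fun i hi => hr i (Fin.castSucc_lt_castSucc_iff.1 hi)⟩

lemma eventually_mem_layerRadii_inside (D : LayeredDisk N) (k : Fin N) :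
    ∀ᶠ r in 𝓝[<] (D.radius k), r ∈ D.layerRadii k.succ := by
  have h1 : ∀ᶠ r in 𝓝[<] (D.radius k), ∀ i : Fin N, k < i → D.radius i < r := by
    refine eventually_all.2 fun i => ?_
    by_cases hi : k < i
    · filter_upwards [mem_nhdsWithin_of_mem_nhds (lt_mem_nhds (D.radius_strictAnti hi))] with r hr _
      exact hr
    · exact Eventually.of_forall fun r h => absurd h hi
  filter_upwards [h1, self_mem_nhdsWithin, mem_nhdsWithin_of_mem_nhds
    (lt_mem_nhds (D.radius_pos k))] with r hr hr' h0
  exact ⟨h0, fun i hi => hr i (Fin.succ_le_castSucc_iff.1 hi),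
    fun i hi => hr'.trans_le (D.radius_strictAnti.antitone (Fin.castSucc_lt_succ_iff.1 hi))⟩

/-- In each layer, the `n`-th Fourier coefficients of the two terms `(z - c) ∂u/∂z` and
`conj (z - c) ∂u/∂z̄` of the radial derivative of a harmonic function are multiples of `r ^ n` and
`r ^ (-n)`. -/
lemma exists_amplitudes (D : LayeredDisk N) {u : ℂ → ℂ} {k : Fin (N + 1)}
    (hu : InnerProductSpace.HarmonicOnNhd u (D.layer k)) (n : ℤ) :
    ∃ A B : ℂ, ∀ r ∈ D.layerRadii k,
      circleCoeff (fun z => (z - D.center) * wirtinger u z) D.center n r = A * (r : ℂ) ^ n ∧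
      circleCoeff (fun z => conj (z - D.center) * wirtingerBar u z) D.center n r =
        B * (r : ℂ) ^ (-n) := by
  obtain ⟨A, hA⟩ := exists_circleCoeff_eq_zpow (D.ordConnected_layerRadii k) (fun r hr => hr.1)
    (h := fun z => (z - D.center) * wirtinger u z) (c := D.center) (fun z hz =>
      (differentiableAt_id.sub_const _).mul
        (differentiableAt_wirtinger (hu z (D.mem_layer_of_dist_mem hz)))) n
  obtain ⟨B, hB⟩ := exists_circleCoeff_eq_zpow (D.ordConnected_layerRadii k) (fun r hr => hr.1)
    (h := fun z => (z - D.center) * wirtinger (fun z => conj (u z)) z) (c := D.center) (fun z hz =>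
      (differentiableAt_id.sub_const _).mul
        (differentiableAt_wirtinger (harmonicAt_conj (hu z (D.mem_layer_of_dist_mem hz))))) (-n)
  refine ⟨A, conj B, fun r hr => ⟨hA r hr, ?_⟩⟩
  have h := circleCoeff_conj
    (fun z => (z - D.center) * wirtinger (fun z => conj (u z)) z) D.center n r
  rw [hB r hr] at h
  simp only [map_mul, ← wirtingerBar_eq_conj, map_zpow₀, Complex.conj_ofReal] at h
  exact h

end LayeredDisk

/-! ### The field outside the inclusion -/

namespace LayeredDisk

variable {N : ℕ}

/-- The relative jump of the conductivity across the `k`-th interface. -/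
noncomputable def contrast (D : LayeredDisk N) (k : Fin N) : ℝ :=
  (D.cond k.castSucc - D.cond k.succ) / (D.cond k.castSucc + D.cond k.succ)

lemma abs_contrast_lt_one (D : LayeredDisk N) (k : Fin N) : |D.contrast k| < 1 := by
  have h1 := D.cond_pos k.castSucc
  have h2 := D.cond_pos k.succ
  rw [contrast, abs_div, abs_of_pos (add_pos h1 h2), div_lt_one (add_pos h1 h2), abs_lt]
  constructor <;> linarith

lemma contrast_ne_zero (D : LayeredDisk N) (k : Fin N) : D.contrast k ≠ 0 :=
  div_ne_zero (sub_ne_zero.2 (D.cond_ne k).symm)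
    (add_pos (D.cond_pos k.castSucc) (D.cond_pos k.succ)).ne'

/-- The factor by which the mode `r ^ n e ^ (i n θ)` about the centre is reflected into
`r ^ (-n) e ^ (i n θ)` by the whole structure. -/
noncomputable def refl (D : LayeredDisk N) (n : ℕ) : ℝ := reflCoeff N D.radius D.contrast n

lemma exists_radius_le (D : LayeredDisk N) : ∃ R, 0 < R ∧ ∀ k, D.radius k ≤ R := by
  obtain ⟨M, hM⟩ := Finite.exists_le D.radius
  exact ⟨max M 1, by positivity, fun k => (hM k).trans (le_max_left _ _)⟩

lemma abs_refl_lt (D : LayeredDisk N) {R : ℝ} (hR : 0 < R) (hle : ∀ k, D.radius k ≤ R) (n : ℕ) :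
    |D.refl n| < R ^ (2 * n) :=
  abs_reflCoeff_lt D.radius_pos D.radius_strictAnti D.abs_contrast_lt_one hR hle n

lemma eventually_refl_ne_zero (hN : 1 ≤ N) (D : LayeredDisk N) : ∀ᶠ n in atTop, D.refl n ≠ 0 := by
  obtain ⟨N, rfl⟩ := Nat.exists_eq_add_of_le' hN
  have h := tendsto_reflCoeff_div D.radius_pos D.radius_strictAnti D.abs_contrast_lt_one
  filter_upwards [h.eventually_ne (D.contrast_ne_zero 0)] with n hn h0
  rw [refl] at h0
  exact hn (by rw [h0, zero_div])

/-- The relations between amplitudes and Fourier coefficients extend from a layer to the interfaces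
that bound it. -/
lemma amplitudes_at_interface (D : LayeredDisk N) {u d : ℂ → ℂ} {j : Fin (N + 1)}
    (hc : Continuous u) (hu : InnerProductSpace.HarmonicOnNhd u (D.layer j)) {ρ : ℝ} {s : Set ℝ}
    [(𝓝[s] ρ).NeBot] (hρ : 0 < ρ) (hs : ∀ᶠ r in 𝓝[s] ρ, r ∈ D.layerRadii j)
    (hd : ∀ θ : ℝ, Tendsto (D.normalDeriv u) (𝓝[D.layer j] (circleMap D.center ρ θ))
      (𝓝 (d (circleMap D.center ρ θ)))) {n : ℤ} {A B : ℂ}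
    (hAB : ∀ r ∈ D.layerRadii j,
      circleCoeff (fun z => (z - D.center) * wirtinger u z) D.center n r = A * (r : ℂ) ^ n ∧
      circleCoeff (fun z => conj (z - D.center) * wirtingerBar u z) D.center n r =
        B * (r : ℂ) ^ (-n)) :
    n * circleCoeff u D.center n ρ = A * (ρ : ℂ) ^ n - B * (ρ : ℂ) ^ (-n) ∧
    ρ * circleCoeff d D.center n ρ = A * (ρ : ℂ) ^ n + B * (ρ : ℂ) ^ (-n) := by
  have hρ' : (ρ : ℂ) ≠ 0 := by exact_mod_cast hρ.ne'
  have hpow : ∀ m : ℤ, Tendsto (fun r : ℝ => (r : ℂ) ^ m) (𝓝[s] ρ) (𝓝 ((ρ : ℂ) ^ m)) := fun m =>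
    (ContinuousAt.zpow₀ (f := fun r : ℝ => (r : ℂ)) (by fun_prop) m
      (Or.inl hρ')).tendsto.mono_left nhdsWithin_le_nhds
  have hsmooth : ∀ r ∈ D.layerRadii j, ∀ θ : ℝ, ContDiffAt ℝ 2 u (circleMap D.center r θ) :=
    fun r hr θ => (hu _ (D.circleMap_mem_layer hr θ)).1
  have hofReal : Tendsto (fun r : ℝ => (r : ℂ)) (𝓝[s] ρ) (𝓝 (ρ : ℂ)) := by
    simpa using hpow 1
  constructor
  · have h1 : Tendsto (circleCoeff u D.center n) (𝓝[s] ρ) (𝓝 (circleCoeff u D.center n ρ)) :=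
      tendsto_circleCoeff (L := Set.univ) n
        (Eventually.of_forall fun r => hc.comp (continuous_circleMap _ _)) (by simp)
        (fun θ => by rw [nhdsWithin_univ]; exact hc.tendsto _)
    refine tendsto_nhds_unique ((h1.const_mul (n : ℂ)).congr' ?_)
      (((hpow n).const_mul A).sub ((hpow (-n)).const_mul B))
    filter_upwards [hs] with r hr
    rw [int_mul_circleCoeff (hsmooth r hr), (hAB r hr).1, (hAB r hr).2]
  · have h1 : Tendsto (circleCoeff (D.normalDeriv u) D.center n) (𝓝[s] ρ)
        (𝓝 (circleCoeff d D.center n ρ)) :=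
      tendsto_circleCoeff n (hs.mono fun r hr => continuous_normalDeriv_circleMap D (hsmooth r hr))
        (hs.mono fun r hr => D.circleMap_mem_layer hr) hd
    refine tendsto_nhds_unique ((hofReal.mul h1).congr' ?_)
      (((hpow n).const_mul A).add ((hpow (-n)).const_mul B))
    filter_upwards [hs] with r hr
    rw [mul_circleCoeff_normalDeriv D hr.1 (hsmooth r hr), (hAB r hr).1, (hAB r hr).2]

lemma eventually_mem_layerRadii_last (D : LayeredDisk N) :
    ∀ᶠ r in 𝓝[>] (0 : ℝ), r ∈ D.layerRadii (Fin.last N) := by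
  have h1 : ∀ᶠ r in 𝓝[>] (0 : ℝ), ∀ i : Fin N, r < D.radius i :=
    eventually_all.2 fun i => mem_nhdsWithin_of_mem_nhds (gt_mem_nhds (D.radius_pos i))
  filter_upwards [h1, self_mem_nhdsWithin] with r hr h0
  exact ⟨h0, fun i hi => absurd hi (not_le.2 (Fin.castSucc_lt_last i)), fun i _ => hr i⟩

lemma center_mem_layer_last (D : LayeredDisk N) : D.center ∈ D.layer (Fin.last N) :=
  ⟨fun i hi => absurd hi (not_le.2 (Fin.castSucc_lt_last i)), fun i _ => by
    rw [dist_self]; exact D.radius_pos i⟩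

lemma mem_layerRadii_zero (D : LayeredDisk N) {r : ℝ} (h0 : 0 < r) (h : ∀ i, D.radius i < r) :
    r ∈ D.layerRadii 0 :=
  ⟨h0, fun i _ => h i, fun _ hi => absurd hi (Fin.not_lt_zero _)⟩

lemma eventually_mem_layerRadii_zero (D : LayeredDisk N) :
    ∀ᶠ r in atTop, r ∈ D.layerRadii 0 := by
  filter_upwards [eventually_gt_atTop 0,
    eventually_all.2 fun i => eventually_gt_atTop (D.radius i)] with r h0 h
  exact D.mem_layerRadii_zero h0 h

/-- The two amplitudes of order `±m` in the exterior of a solution are related by the reflection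
coefficient of order `m`. -/
theorem IsSolution.exterior_amplitudes {D : LayeredDisk N} {H u : ℂ → ℂ} (h : D.IsSolution H u)
    (n : ℤ) (m : ℕ) (hm : n.natAbs = m) {A₀ B₀ : ℂ}
    (h₀ : ∀ r ∈ D.layerRadii 0,
      circleCoeff (fun z => (z - D.center) * wirtinger u z) D.center n r = A₀ * (r : ℂ) ^ n ∧
      circleCoeff (fun z => conj (z - D.center) * wirtingerBar u z) D.center n r =
        B₀ * (r : ℂ) ^ (-n)) :
    (0 ≤ n → B₀ = -(D.refl m : ℝ) * A₀) ∧ (n ≤ 0 → A₀ = -(D.refl m : ℝ) * B₀) := by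
  choose A B hAB using fun k => D.exists_amplitudes (h.harmonic k) n
  -- The amplitudes in the exterior are unique.
  obtain ⟨hA₀, hB₀⟩ : A 0 = A₀ ∧ B 0 = B₀ := by
    obtain ⟨r, hr⟩ := D.eventually_mem_layerRadii_zero.exists
    have hr' : (r : ℂ) ≠ 0 := by exact_mod_cast hr.1.ne'
    exact ⟨mul_right_cancel₀ (zpow_ne_zero n hr') ((hAB 0 r hr).1.symm.trans (h₀ r hr).1),
      mul_right_cancel₀ (zpow_ne_zero (-n) hr') ((hAB 0 r hr).2.symm.trans (h₀ r hr).2)⟩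
  have hmem : ∀ (k : Fin N) (θ : ℝ), circleMap D.center (D.radius k) θ ∈ D.interface k :=
    fun k θ => circleMap_mem_sphere _ (D.radius_pos k).le θ
  have htrans : ∀ k : Fin N,
      (A k.castSucc * (D.radius k : ℂ) ^ n - B k.castSucc * (D.radius k : ℂ) ^ (-n) =
        A k.succ * (D.radius k : ℂ) ^ n - B k.succ * (D.radius k : ℂ) ^ (-n)) ∧
      ((D.cond k.castSucc : ℂ) *
          (A k.castSucc * (D.radius k : ℂ) ^ n + B k.castSucc * (D.radius k : ℂ) ^ (-n)) =
        D.cond k.succ * (A k.succ * (D.radius k : ℂ) ^ n + B k.succ * (D.radius k : ℂ) ^ (-n))) := by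
    intro k
    choose! dOut dIn hOut hIn hjump using h.flux k
    obtain ⟨e1, e2⟩ := D.amplitudes_at_interface h.continuous (h.harmonic k.castSucc)
      (D.radius_pos k) (D.eventually_mem_layerRadii_outside k) (d := dOut)
      (fun θ => hOut _ (hmem k θ)) (hAB k.castSucc)
    obtain ⟨e3, e4⟩ := D.amplitudes_at_interface h.continuous (h.harmonic k.succ)
      (D.radius_pos k) (D.eventually_mem_layerRadii_inside k) (d := dIn)
      (fun θ => hIn _ (hmem k θ)) (hAB k.succ)
    refine ⟨e1.symm.trans e3, ?_⟩
    have e5 := circleCoeff_congr (v := fun z => (D.cond k.castSucc : ℂ) * dOut z)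
      (w := fun z => (D.cond k.succ : ℂ) * dIn z) n fun θ => hjump _ (hmem k θ)
    rw [circleCoeff_const_mul, circleCoeff_const_mul] at e5
    rw [← e2, ← e4]
    linear_combination (D.radius k : ℂ) * e5
  have hharm := h.harmonic _ _ D.center_mem_layer_last
  have hlastB : 0 ≤ n → B (Fin.last N) = 0 := fun hn => by
    refine eq_zero_of_tendsto_mul_zpow_nhdsGT hn ?_
    have hw := (differentiableAt_wirtinger (harmonicAt_conj hharm)).continuousAt
    refine (tendsto_circleCoeff_nhdsGT_zero (c := D.center)
      (v := fun z => conj (z - D.center) * wirtingerBar u z) ?_ (by simp) n).congr' ?_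
    · simp only [wirtingerBar_eq_conj]
      exact ContinuousAt.mul (by fun_prop) (Complex.continuous_conj.continuousAt.comp hw)
    · filter_upwards [D.eventually_mem_layerRadii_last] with r hr
      exact (hAB _ r hr).2
  have hlastA : n ≤ 0 → A (Fin.last N) = 0 := fun hn => by
    refine eq_zero_of_tendsto_mul_zpow_nhdsGT (n := -n) (by omega) ?_
    have hw := (differentiableAt_wirtinger hharm).continuousAt
    refine (tendsto_circleCoeff_nhdsGT_zero (c := D.center)
      (v := fun z => (z - D.center) * wirtinger u z)
      (ContinuousAt.mul (by fun_prop) hw) (by simp) n).congr' ?_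
    filter_upwards [D.eventually_mem_layerRadii_last] with r hr
    rw [neg_neg]
    exact (hAB _ r hr).1
  subst hA₀ hB₀
  constructor
  · intro hn
    obtain rfl : n = m := by omega
    refine eq_neg_reflCoeff_mul D.radius_pos D.radius_strictAnti D.cond_pos m A B
      (fun k => ?_) (fun k => ?_) (hlastB hn)
    · simpa [div_eq_mul_inv, zpow_neg] using (htrans k).1
    · simpa [div_eq_mul_inv, zpow_neg] using (htrans k).2
  · intro hn
    obtain rfl : n = -m := by omega
    -- Reversing the sign of `n` exchanges the two amplitudes up to sign.
    have := eq_neg_reflCoeff_mul D.radius_pos D.radius_strictAnti D.cond_pos m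
      (fun k => -B k) (fun k => -A k) (fun k => ?_) (fun k => ?_) (by simp [hlastA hn])
    · rw [mul_neg, neg_inj] at this
      exact this
    · have := (htrans k).1
      simp only [neg_neg, zpow_neg, zpow_natCast] at this
      simp only [div_eq_mul_inv]
      linear_combination this
    · have := (htrans k).2
      simp only [neg_neg, zpow_neg, zpow_natCast] at this
      simp only [div_eq_mul_inv]
      linear_combination -this

lemma IsSolution.tendsto_sub {D : LayeredDisk N} {H u : ℂ → ℂ} (h : D.IsSolution H u) :
    Tendsto (fun z => u z - H z) (cocompact ℂ) (𝓝 0) :=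
  h.decay.trans_tendsto (tendsto_norm_cocompact_atTop (E := ℂ)).inv_tendsto_atTop

/-- The Fourier coefficients in the exterior of a solution whose background potential has the
Taylor coefficients `b` about the centre. -/
lemma IsSolution.exterior_circleCoeff {D : LayeredDisk N} {H u : ℂ → ℂ} (h : D.IsSolution H u)
    (hH : Differentiable ℂ H) {b : ℕ → ℂ}
    (hHb : ∀ r : ℝ, 0 < r → ∀ n : ℕ, circleCoeff H D.center n r = b n * (r : ℂ) ^ n)
    (hH0 : ∀ r : ℝ, 0 < r → ∀ n : ℤ, n < 0 → circleCoeff H D.center n r = 0) :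
    (∀ n : ℤ, ∀ r ∈ D.layerRadii 0,
      circleCoeff (fun z => (z - D.center) * wirtinger u z) D.center n r =
        n * circleCoeff H D.center n r) ∧
    ∀ m : ℕ, m ≠ 0 → ∀ r ∈ D.layerRadii 0,
      circleCoeff (fun z => u z - H z) D.center m r = D.refl m * b m * (r : ℂ) ^ (-m : ℤ) := by
  have hsmooth : ∀ r ∈ D.layerRadii 0, ∀ θ : ℝ, ContDiffAt ℝ 2 u (circleMap D.center r θ) :=
    fun r hr θ => (h.harmonic 0 _ (D.circleMap_mem_layer hr θ)).1
  have hsub : ∀ (n : ℤ) (r : ℝ), circleCoeff (fun z => u z - H z) D.center n r =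
      circleCoeff u D.center n r - circleCoeff H D.center n r := fun n r =>
    circleCoeff_sub n (h.continuous.comp (continuous_circleMap _ _))
      (hH.continuous.comp (continuous_circleMap _ _))
  choose A B hAB using D.exists_amplitudes (h.harmonic 0)
  have hu : ∀ (n : ℤ), ∀ r ∈ D.layerRadii 0, n * circleCoeff u D.center n r =
      A n * (r : ℂ) ^ n - B n * (r : ℂ) ^ (-n) := fun n r hr => by
    rw [int_mul_circleCoeff (hsmooth r hr), (hAB n r hr).1, (hAB n r hr).2]
  have hlim : ∀ n : ℤ, Tendsto (fun r : ℝ => n * circleCoeff (fun z => u z - H z) D.center n r)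
      atTop (𝓝 0) := fun n => by
    simpa using (tendsto_circleCoeff_atTop h.tendsto_sub D.center n).const_mul (n : ℂ)
  have hpos : ∀ m : ℕ, m ≠ 0 → A m = m * b m ∧ B m = -(D.refl m : ℝ) * (m * b m) := fun m hm => by
    have hA : A m - m * b m = 0 := by
      have h1 := (tendsto_ofReal_zpow_neg_atTop (n := m) (by omega)).const_mul (B m)
      have h2 := (hlim m).add h1
      rw [mul_zero, add_zero] at h2
      refine eq_zero_of_tendsto_mul_zpow_atTop (n := m) (by omega) (h2.congr' ?_)
      filter_upwards [D.eventually_mem_layerRadii_zero] with r hr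
      rw [hsub, mul_sub, hu m r hr, hHb r hr.1, zpow_natCast, Int.cast_natCast]
      ring
    have hA' := sub_eq_zero.1 hA
    exact ⟨hA', by rw [← hA']; exact (h.exterior_amplitudes m m rfl (hAB m)).1 (by omega)⟩
  have hzero : A 0 = 0 := by
    have h1 := (h.exterior_amplitudes 0 0 rfl (hAB 0)).1 le_rfl
    obtain ⟨r, hr⟩ := D.eventually_mem_layerRadii_zero.exists
    have h2 := hu 0 r hr
    simp only [Int.cast_zero, zero_mul, neg_zero, zpow_zero, mul_one, h1] at h2
    obtain ⟨R, hR, hle⟩ := D.exists_radius_le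
    have h3 := (abs_lt.1 (D.abs_refl_lt hR hle 0)).1
    rw [mul_zero, pow_zero] at h3
    have h4 : (1 + (D.refl 0 : ℝ) : ℂ) ≠ 0 := by
      exact_mod_cast (by linarith : (0 : ℝ) < 1 + D.refl 0).ne'
    exact (mul_eq_zero.1 (by linear_combination -h2 : (1 + (D.refl 0 : ℝ) : ℂ) * A 0 = 0)).resolve_left
      h4
  have hneg : ∀ n : ℤ, n < 0 → A n = 0 := fun n hn => by
    have hB : -B n = 0 := by
      have h1 := (tendsto_ofReal_zpow_neg_atTop (n := -n) (by omega)).const_mul (A n)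
      have h2 := (hlim n).sub h1
      rw [mul_zero, sub_zero] at h2
      refine eq_zero_of_tendsto_mul_zpow_atTop (n := -n) (by omega) (h2.congr' ?_)
      filter_upwards [D.eventually_mem_layerRadii_zero] with r hr
      rw [hsub, mul_sub, hu n r hr, hH0 r hr.1 n hn, neg_neg]
      ring
    rw [(h.exterior_amplitudes n _ rfl (hAB n)).2 hn.le, neg_eq_zero.1 hB, mul_zero]
  refine ⟨fun n r hr => ?_, fun m hm r hr => ?_⟩
  · rw [(hAB n r hr).1]
    rcases lt_trichotomy n 0 with hn | rfl | hn
    · rw [hneg n hn, hH0 r hr.1 n hn]; ring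
    · rw [hzero]; simp
    · obtain ⟨m, rfl⟩ := Int.eq_ofNat_of_zero_le hn.le
      rw [(hpos m (by omega)).1, hHb r hr.1, zpow_natCast, Int.cast_natCast, mul_assoc]
  · have hm' : (m : ℂ) ≠ 0 := by exact_mod_cast hm
    have h1 := hu m r hr
    rw [(hpos m hm).1, (hpos m hm).2, zpow_natCast, Int.cast_natCast] at h1
    rw [hsub, hHb r hr.1]
    refine mul_left_cancel₀ hm' ?_
    linear_combination h1

/-- In the exterior, a solution differs from the background potential by an antiholomorphic
function, which is given by the reflection coefficients and the Taylor coefficients `b` of the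
background potential about the centre. -/
theorem IsSolution.hasSum_exterior {D : LayeredDisk N} {H u : ℂ → ℂ} (h : D.IsSolution H u)
    (hH : Differentiable ℂ H) {b : ℕ → ℂ}
    (hb : ∀ T : ℝ, 0 < T → Summable fun n => ‖b n‖ * T ^ n)
    (hHb : ∀ r : ℝ, 0 < r → ∀ n : ℕ, circleCoeff H D.center n r = b n * (r : ℂ) ^ n)
    (hH0 : ∀ r : ℝ, 0 < r → ∀ n : ℤ, n < 0 → circleCoeff H D.center n r = 0)
    {z : ℂ} (hz : z ≠ D.center) (hzr : ∀ i, D.radius i < dist z D.center) :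
    HasSum (fun n : ℕ => conj (D.refl (n + 1) * b (n + 1)) * ((z - D.center)⁻¹) ^ (n + 1))
      (conj (u z - H z)) := by
  set c := D.center with hc
  set w : ℂ → ℂ := fun z => u z - H z with hw
  obtain ⟨hcu, hcw⟩ := h.exterior_circleCoeff hH hHb hH0
  have hHharm : ∀ z, InnerProductSpace.HarmonicAt H z := fun z => (hH.analyticAt z).harmonicAt
  have hdist : ∀ r ∈ D.layerRadii 0, ∀ θ, circleMap c r θ ∈ D.layer 0 :=
    fun r hr θ => D.circleMap_mem_layer hr θ
  have hwirt : ∀ z ∈ D.layer 0, wirtinger w z = wirtinger u z - wirtinger H z := fun z hz => by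
    have h1 := (h.harmonic 0 z hz).1.differentiableAt (by norm_num)
    have h2 := (hHharm z).1.differentiableAt (by norm_num)
    simp only [wirtinger, hw, fderiv_fun_sub h1 h2, sub_apply]
    ring
  -- All Fourier coefficients of `(z - c) ∂w/∂z` vanish, so that `w` is antiholomorphic.
  have hw0 : ∀ z, dist z c ∈ D.layerRadii 0 → wirtinger w z = 0 := fun z hz => by
    obtain ⟨θ, hθ⟩ := exists_circleMap_eq c z
    have hr : 0 < dist z c := hz.1
    generalize dist z c = r at hz hθ hr
    have hcu' := (continuous_wirtinger_circleMap (c := c) (r := r)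
      fun θ => (h.harmonic 0 _ (hdist r hz θ)).1).1
    have hcH := (continuous_wirtinger_circleMap (c := c) (r := r)
      fun θ => hH.contDiffAt_real _).1
    have hz0 : ∀ n : ℤ, circleCoeff (fun z => (z - c) * wirtinger u z - (z - c) * wirtinger H z)
        c n r = 0 := fun n => by
      have hbar : circleCoeff (fun z => conj (z - c) * wirtingerBar H z) c n r = 0 := by
        rw [circleCoeff_congr (w := fun _ => 0) n fun θ => by
          rw [wirtingerBar_eq_zero (hH _), mul_zero]]
        simp [circleCoeff]
      rw [circleCoeff_sub n hcu' hcH, hcu n r hz,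
        int_mul_circleCoeff (fun θ => hH.contDiffAt_real _) n, hbar, sub_zero, sub_self]
    have hs := hasSum_circleCoeff
      (v := fun z => (z - c) * wirtinger u z - (z - c) * wirtinger H z) (hcu'.sub hcH)
      (by simp only [hz0]; exact summable_zero) θ
    simp only [hz0, zero_mul] at hs
    have h0 := hs.unique hasSum_zero
    rw [← mul_sub, ← hwirt _ (hdist r hz θ), ← hθ] at h0
    refine (mul_eq_zero.1 h0).resolve_left fun h1 => hr.ne' ?_
    have h2 := dist_circleMap_center (c := c) hr θ
    rw [← hθ, sub_eq_zero.1 h1, dist_self] at h2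
    exact h2.symm
  have hF : ∀ z, dist z c ∈ D.layerRadii 0 → DifferentiableAt ℂ (fun z => conj (w z)) z :=
    fun z hz => by
      have hharm := (h.harmonic 0 z (D.mem_layer_of_dist_mem hz)).sub (hHharm z)
      refine differentiableAt_of_wirtingerBar_eq_zero
        ((harmonicAt_conj hharm).1.differentiableAt (by norm_num)) ?_
      rw [wirtingerBar_eq_conj]
      simp only [Complex.conj_conj]
      rw [hw0 z hz, map_zero]
  choose A hA using fun n : ℤ =>
    exists_circleCoeff_eq_zpow (D.ordConnected_layerRadii 0) (fun r hr => hr.1) hF n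
  have hApos : ∀ n : ℤ, 0 ≤ n → A n = 0 := fun n hn => by
    have h1 : Tendsto (fun z => conj (w z)) (cocompact ℂ) (𝓝 0) := by
      have h2 := (Complex.continuous_conj.tendsto 0).comp h.tendsto_sub
      rwa [map_zero] at h2
    refine eq_zero_of_tendsto_mul_zpow_atTop hn
      ((tendsto_circleCoeff_atTop h1 c n).congr' ?_)
    filter_upwards [D.eventually_mem_layerRadii_zero] with r hr
    exact hA n r hr
  obtain ⟨θ, hθ⟩ := exists_circleMap_eq c z
  have hr : dist z c ∈ D.layerRadii 0 := D.mem_layerRadii_zero (dist_pos.2 hz) hzr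
  generalize dist z c = r at hr hθ
  have hr' : (r : ℂ) ≠ 0 := by exact_mod_cast hr.1.ne'
  have hcoeff : ∀ n : ℕ, circleCoeff (fun z => conj (w z)) c (-((n + 1 : ℕ) : ℤ)) r =
      conj (D.refl (n + 1) * b (n + 1)) * ((r : ℂ)⁻¹) ^ (n + 1) := fun n => by
    rw [circleCoeff_conj, neg_neg, hcw (n + 1) (by omega) r hr, map_mul, map_zpow₀,
      Complex.conj_ofReal, zpow_neg, zpow_natCast, inv_pow]
  have hzero : ∀ n : ℤ, n ∉ Set.range (fun n : ℕ => -((n + 1 : ℕ) : ℤ)) →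
      circleCoeff (fun z => conj (w z)) c n r = 0 := fun n hn => by
    rw [hA n r hr, hApos n, zero_mul]
    by_contra hlt
    exact hn ⟨(-n - 1).toNat, by simp only []; omega⟩
  have hinj : Function.Injective (fun n : ℕ => -((n + 1 : ℕ) : ℤ)) := fun a b hab => by
    simp only [] at hab; omega
  have hsummable : Summable fun n : ℤ => circleCoeff (fun z => conj (w z)) c n r := by
    rw [← hinj.summable_iff hzero]
    obtain ⟨R, hR, hle⟩ := D.exists_radius_le
    refine Summable.of_norm_bounded ((summable_nat_add_iff 1).2
      (hb (R ^ 2 * r⁻¹) (mul_pos (pow_pos hR 2) (inv_pos.2 hr.1)))) fun n => ?_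
    rw [Function.comp_apply, hcoeff, norm_mul, RCLike.norm_conj, norm_mul, norm_pow, norm_inv,
      Complex.norm_real, Complex.norm_real, Real.norm_of_nonneg hr.1.le, mul_pow, ← pow_mul,
      Real.norm_eq_abs]
    have h1 := (D.abs_refl_lt hR hle (n + 1)).le
    have h2 : 0 ≤ ‖b (n + 1)‖ * r⁻¹ ^ (n + 1) :=
      mul_nonneg (norm_nonneg _) (pow_nonneg (inv_nonneg.2 hr.1.le) _)
    nlinarith [mul_le_mul_of_nonneg_right h1 h2]
  have hcont : Continuous fun θ : ℝ => conj (w (circleMap c r θ)) :=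
    Complex.continuous_conj.comp ((h.continuous.comp (continuous_circleMap _ _)).sub
      (hH.continuous.comp (continuous_circleMap _ _)))
  have hsum := hasSum_circleCoeff (v := fun z => conj (w z)) hcont hsummable θ
  rw [← hinj.hasSum_iff (fun n hn => by rw [hzero n hn, zero_mul]), ← hθ] at hsum
  refine hsum.congr_fun fun n => ?_
  rw [Function.comp_apply, hcoeff, hθ, circleMap_sub_center, circleMap_zero, mul_inv, mul_pow,
    ← Complex.exp_neg, ← Complex.exp_nat_mul, mul_assoc]
  congr 3
  push_cast
  ring

end LayeredDisk

/-! ### Continuation of the scattered field -/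

lemma hasFPowerSeriesOnBall_of_hasSum {a : ℕ → ℂ} {f : ℂ → ℂ}
    (h : ∀ z, HasSum (fun n => a n * z ^ n) (f z)) :
    HasFPowerSeriesOnBall f (FormalMultilinearSeries.ofScalars ℂ a) 0 ⊤ where
  r_le := by
    refine (FormalMultilinearSeries.radius_eq_top_of_summable_norm _ fun r => ?_).ge
    refine (h ((r : ℝ) : ℂ)).summable.norm.congr fun n => ?_
    rw [FormalMultilinearSeries.ofScalars_norm, norm_mul, norm_pow, Complex.norm_real,
      Real.norm_of_nonneg r.coe_nonneg]
  r_pos := ENNReal.zero_lt_top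
  hasSum := fun {y} _ => by
    simpa only [FormalMultilinearSeries.ofScalars_apply_eq, zero_add, smul_eq_mul] using h y

lemma differentiable_of_hasSum {a : ℕ → ℂ} {f : ℂ → ℂ}
    (h : ∀ z, HasSum (fun n => a n * z ^ n) (f z)) : Differentiable ℂ f := fun z =>
  ((hasFPowerSeriesOnBall_of_hasSum h).analyticAt_of_mem (by simp)).differentiableAt

lemma coeff_unique_of_hasSum {a a' : ℕ → ℂ} {f : ℂ → ℂ}
    (h : ∀ z, HasSum (fun n => a n * z ^ n) (f z))
    (h' : ∀ z, HasSum (fun n => a' n * z ^ n) (f z)) : a = a' :=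
  FormalMultilinearSeries.ofScalars_series_injective ℂ ℂ
    ((hasFPowerSeriesOnBall_of_hasSum h).hasFPowerSeriesAt.eq_formalMultilinearSeries
      (hasFPowerSeriesOnBall_of_hasSum h').hasFPowerSeriesAt)

/-- Whether an entire function is a polynomial of degree less than `m` can be seen from the
expansion about any point. -/
lemma coeff_eq_zero_of_taylor_eq_zero {a b : ℕ → ℂ} {H : ℂ → ℂ} {c : ℂ} {m : ℕ}
    (ha : ∀ z, HasSum (fun n => a n * z ^ n) (H z))
    (hb : ∀ z, z ≠ c → HasSum (fun n => b n * (z - c) ^ n) (H z))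
    (h0 : ∀ n, m ≤ n → b n = 0) : ∀ n, m ≤ n → a n = 0 := by
  set P : Polynomial ℂ := ∑ n ∈ Finset.range m,
    Polynomial.C (b n) * (Polynomial.X - Polynomial.C c) ^ n with hP
  have hne : ∀ z, z ≠ c → H z = P.eval z := fun z hz => by
    have h1 := hasSum_sum_of_ne_finset_zero (f := fun n => b n * (z - c) ^ n)
      (L := SummationFilter.unconditional ℕ) (s := Finset.range m) (fun n hn => by rw [h0 n (by simpa using hn), zero_mul])
    rw [(hb z hz).unique h1, hP, Polynomial.eval_finsetSum]
    simp
  have hH : H = fun z => P.eval z :=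
    (differentiable_of_hasSum ha).continuous.ext_on (dense_compl_singleton c) P.continuous hne
  have hPsum : ∀ z, HasSum (fun n => P.coeff n * z ^ n) (H z) := fun z => by
    rw [hH]
    simp only [Polynomial.eval_eq_sum_range]
    refine hasSum_sum_of_ne_finset_zero fun n hn => ?_
    rw [Polynomial.coeff_eq_zero_of_natDegree_lt (by simpa using hn), zero_mul]
  intro n hn
  rw [coeff_unique_of_hasSum ha hPsum, hP, Polynomial.finsetSum_coeff]
  refine Finset.sum_eq_zero fun k hk => Polynomial.coeff_eq_zero_of_natDegree_lt ?_
  calc _ ≤ ((Polynomial.X - Polynomial.C c : Polynomial ℂ) ^ k).natDegree :=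
        Polynomial.natDegree_C_mul_le _ _
    _ ≤ k * (Polynomial.X - Polynomial.C c : Polynomial ℂ).natDegree :=
        Polynomial.natDegree_pow_le
    _ = k := by rw [Polynomial.natDegree_X_sub_C, mul_one]
    _ < n := (Finset.mem_range.1 hk).trans_le hn

namespace LayeredDisk

variable {N : ℕ}

/-- The coefficients of the conjugate of the scattered field as a power series in
`(z - center)⁻¹`, for a background potential with the Taylor coefficients `b`. -/
noncomputable def scatteredCoeff (D : LayeredDisk N) (b : ℕ → ℂ) (n : ℕ) : ℂ :=
  if n = 0 then 0 else conj (D.refl n * b n)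

lemma summable_scatteredCoeff (D : LayeredDisk N) {b : ℕ → ℂ}
    (hb : ∀ T : ℝ, 0 < T → Summable fun n => ‖b n‖ * T ^ n) (ζ : ℂ) :
    Summable fun n => D.scatteredCoeff b n * ζ ^ n := by
  obtain ⟨R, hR, hle⟩ := D.exists_radius_le
  refine Summable.of_norm_bounded (hb (R ^ 2 * (‖ζ‖ + 1)) (by positivity)) fun n => ?_
  rw [norm_mul, norm_pow, mul_pow, ← pow_mul, ← mul_assoc]
  refine mul_le_mul ?_ (pow_le_pow_left₀ (norm_nonneg _) (by linarith) n) (by positivity)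
    (by positivity)
  rw [scatteredCoeff]
  split_ifs
  · rw [norm_zero]; positivity
  · rw [RCLike.norm_conj, norm_mul, Complex.norm_real, Real.norm_eq_abs, mul_comm]
    exact mul_le_mul_of_nonneg_left (D.abs_refl_lt hR hle n).le (norm_nonneg _)

/-- The conjugate of the scattered field, as an entire function of `ζ = (z - center)⁻¹`. -/
noncomputable def scattered (D : LayeredDisk N) (b : ℕ → ℂ) (ζ : ℂ) : ℂ :=
  ∑' n, D.scatteredCoeff b n * ζ ^ n

lemma hasSum_scattered (D : LayeredDisk N) {b : ℕ → ℂ}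
    (hb : ∀ T : ℝ, 0 < T → Summable fun n => ‖b n‖ * T ^ n) (ζ : ℂ) :
    HasSum (fun n => D.scatteredCoeff b n * ζ ^ n) (D.scattered b ζ) :=
  (D.summable_scatteredCoeff hb ζ).hasSum

lemma scattered_zero (D : LayeredDisk N) (b : ℕ → ℂ) : D.scattered b 0 = 0 := by
  rw [scattered, tsum_eq_single 0 fun n hn => by rw [zero_pow hn, mul_zero]]
  simp [scatteredCoeff]

theorem IsSolution.conj_sub_eq_scattered {D : LayeredDisk N} {H u : ℂ → ℂ} (h : D.IsSolution H u)
    (hH : Differentiable ℂ H) {b : ℕ → ℂ}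
    (hb : ∀ T : ℝ, 0 < T → Summable fun n => ‖b n‖ * T ^ n)
    (hHb : ∀ r : ℝ, 0 < r → ∀ n : ℕ, circleCoeff H D.center n r = b n * (r : ℂ) ^ n)
    (hH0 : ∀ r : ℝ, 0 < r → ∀ n : ℤ, n < 0 → circleCoeff H D.center n r = 0)
    {z : ℂ} (hz : z ≠ D.center) (hzr : ∀ i, D.radius i < dist z D.center) :
    conj (u z - H z) = D.scattered b (z - D.center)⁻¹ := by
  have h1 := h.hasSum_exterior hH hb hHb hH0 hz hzr
  have h2 := (hasSum_nat_add_iff' 1).2 (D.hasSum_scattered hb (z - D.center)⁻¹)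
  rw [Finset.sum_range_one, scatteredCoeff, if_pos rfl, zero_mul, sub_zero] at h2
  exact h1.unique (h2.congr_fun fun n => by rw [scatteredCoeff, if_neg n.succ_ne_zero])

lemma center_ne_and_radius_lt_of_notMem_inclusion (hN : 1 ≤ N) (D : LayeredDisk N) {z : ℂ}
    (hz : z ∉ D.inclusion) : z ≠ D.center ∧ ∀ i, D.radius i < dist z D.center := by
  have h : ∀ i, D.radius i < dist z D.center := fun i =>
    not_le.1 fun hi => hz (Set.mem_iUnion.2 ⟨i, hi⟩)
  refine ⟨fun h0 => ?_, h⟩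
  have h1 := h ⟨0, hN⟩
  rw [h0, dist_self] at h1
  exact absurd (D.radius_pos _) (not_lt.2 h1.le)

end LayeredDisk

lemma analyticAt_comp_inv_sub {G : ℂ → ℂ} (hG : Differentiable ℂ G) {c z : ℂ} (hz : z ≠ c) :
    AnalyticAt ℂ (fun z => G (z - c)⁻¹) z :=
  (hG.analyticAt _).comp (f := fun z => (z - c)⁻¹)
    ((analyticAt_id.sub analyticAt_const).inv (sub_ne_zero.2 hz))

lemma tendsto_comp_inv_sub_cocompact {G : ℂ → ℂ} (hG : Continuous G) (h0 : G 0 = 0) (c : ℂ) :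
    Tendsto (fun z => G (z - c)⁻¹) (cocompact ℂ) (𝓝 0) := by
  have h1 : Tendsto (fun z : ℂ => (z - c)⁻¹) (cocompact ℂ) (𝓝 0) := by
    rw [← Metric.cobounded_eq_cocompact]
    exact (Filter.tendsto_inv₀_cobounded (α := ℂ)).comp (tendsto_sub_const_cobounded c)
  have h2 := hG.tendsto 0
  rw [h0] at h2
  exact h2.comp h1

/-- Functions with essential singularities (at most) at two different points and nowhere else,
the point at infinity included, can only agree if they vanish: their common values extend to a
bounded entire function. -/
lemma eq_zero_of_comp_inv_sub_eq {G₁ G₂ : ℂ → ℂ} (h₁ : Differentiable ℂ G₁)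
    (h₂ : Differentiable ℂ G₂) (h0 : G₁ 0 = 0) {c₁ c₂ : ℂ} (hc : c₁ ≠ c₂)
    (h : ∀ z, z ≠ c₁ → z ≠ c₂ → G₁ (z - c₁)⁻¹ = G₂ (z - c₂)⁻¹) (ζ : ℂ) : G₁ ζ = 0 := by
  classical
  set E : ℂ → ℂ := Function.update (fun z => G₁ (z - c₁)⁻¹) c₁ (G₂ (c₁ - c₂)⁻¹) with hE
  have hE1 : ∀ z, z ≠ c₁ → E z = G₁ (z - c₁)⁻¹ := fun z hz => by
    rw [hE, Function.update_of_ne hz]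
  have hE2 : ∀ z, z ≠ c₂ → E z = G₂ (z - c₂)⁻¹ := fun z hz => by
    by_cases hz1 : z = c₁
    · rw [hz1, hE, Function.update_self]
    · rw [hE1 z hz1, h z hz1 hz]
  have hdiff : Differentiable ℂ E := fun z => by
    by_cases hz : z = c₁
    · have hz2 : z ≠ c₂ := hz ▸ hc
      exact (analyticAt_comp_inv_sub h₂ hz2).differentiableAt.congr_of_eventuallyEq
        ((eventually_ne_nhds hz2).mono hE2)
    · exact (analyticAt_comp_inv_sub h₁ hz).differentiableAt.congr_of_eventuallyEq
        ((eventually_ne_nhds hz).mono hE1)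
  have hlim : Tendsto E (cocompact ℂ) (𝓝 0) := by
    refine (tendsto_comp_inv_sub_cocompact h₁.continuous h0 c₁).congr' ?_
    have hcpt : ({c₁}ᶜ : Set ℂ) ∈ cocompact ℂ := isCompact_singleton.compl_mem_cocompact
    filter_upwards [hcpt] with z hz using (hE1 z hz).symm
  by_cases hζ : ζ = 0
  · rw [hζ, h0]
  · have h1 := hE1 (c₁ + ζ⁻¹) (by simpa using hζ)
    rw [hdiff.apply_eq_of_tendsto_cocompact _ hlim] at h1
    simpa using h1.symm

theorem theorem4p3 {N : ℕ} (hN : 1 ≤ N) (D₁ D₂ : LayeredDisk N)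
    -- a bounded domain `Ω` enclosing both inclusions, and a relatively open piece `S` of `∂Ω`
    (Ω S : Set ℂ) (hΩ_open : IsOpen Ω) (hΩ_conn : IsConnected Ω)
    (hΩ_bdd : Bornology.IsBounded Ω)
    (hΩ_encl : D₁.inclusion ∪ D₂.inclusion ⊆ Ω)
    (hS_open : ∃ U : Set ℂ, IsOpen U ∧ S = U ∩ frontier Ω)
    (hS_ne : S.Nonempty) (hS_perf : Preperfect S)
    -- background potentials `H i = ∑ a i n * r ^ n * e ^ (i n θ)` (one of them, or a family)
    -- in which modes of arbitrarily large order occur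
    {ι : Type*} (a : ι → ℕ → ℂ) (H : ι → ℂ → ℂ)
    (hH : ∀ i z, HasSum (fun n : ℕ => a i n * z ^ n) (H i z))
    (hmodes : ∀ m : ℕ, ∃ i, ∃ n, m ≤ n ∧ a i n ≠ 0)
    -- the total fields, and their agreement on `S`
    (u₁ u₂ : ι → ℂ → ℂ)
    (hu₁ : ∀ i, D₁.IsSolution (H i) (u₁ i))
    (hu₂ : ∀ i, D₂.IsSolution (H i) (u₂ i))
    (hmeas : ∀ i, Set.EqOn (u₁ i) (u₂ i) S) :
    D₁.center = D₂.center ∧ ∀ k, D₁.radius k = D₂.radius k := by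
  have hent : ∀ i, Differentiable ℂ (H i) := fun i => differentiable_of_hasSum (hH i)
  choose b₁ hb₁ ht₁ hc₁ hn₁ using fun i => exists_taylor_circleCoeff (hent i) D₁.center
  choose b₂ hb₂ ht₂ hc₂ hn₂ using fun i => exists_taylor_circleCoeff (hent i) D₂.center
  have hd₁ : ∀ i, Differentiable ℂ (D₁.scattered (b₁ i)) := fun i =>
    differentiable_of_hasSum (D₁.hasSum_scattered (hb₁ i))
  have hd₂ : ∀ i, Differentiable ℂ (D₂.scattered (b₂ i)) := fun i =>
    differentiable_of_hasSum (D₂.hasSum_scattered (hb₂ i))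
  have hSΩ : ∀ z ∈ S, z ∉ Ω := fun z hz hzΩ => by
    obtain ⟨U, -, rfl⟩ := hS_open
    have := hz.2.2
    rw [hΩ_open.interior_eq] at this
    exact this hzΩ
  have hS₁ : ∀ z ∈ S, z ≠ D₁.center ∧ ∀ i, D₁.radius i < dist z D₁.center := fun z hz =>
    D₁.center_ne_and_radius_lt_of_notMem_inclusion hN
      fun h => hSΩ z hz (hΩ_encl (Or.inl h))
  have hS₂ : ∀ z ∈ S, z ≠ D₂.center ∧ ∀ i, D₂.radius i < dist z D₂.center := fun z hz =>
    D₂.center_ne_and_radius_lt_of_notMem_inclusion hN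
      fun h => hSΩ z hz (hΩ_encl (Or.inr h))
  -- The two scattered fields, continued to the plane punctured at the centres, agree.
  have hagree : ∀ i z, z ≠ D₁.center → z ≠ D₂.center →
      D₁.scattered (b₁ i) (z - D₁.center)⁻¹ = D₂.scattered (b₂ i) (z - D₂.center)⁻¹ := by
    intro i z hz₁ hz₂
    obtain ⟨x, hx⟩ := hS_ne
    have hU : IsPreconnected ({D₁.center, D₂.center}ᶜ : Set ℂ) :=
      ((Set.toFinite _).countable.isConnected_compl_of_one_lt_rank
        (by rw [Complex.rank_real_complex]; norm_num)).isPreconnected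
    refine AnalyticOnNhd.eqOn_of_preconnected_of_frequently_eq (z₀ := x)
      (U := {D₁.center, D₂.center}ᶜ)
      (f := fun z => D₁.scattered (b₁ i) (z - D₁.center)⁻¹)
      (g := fun z => D₂.scattered (b₂ i) (z - D₂.center)⁻¹)
      (fun z hz => analyticAt_comp_inv_sub (hd₁ i) fun h => hz (Or.inl h))
      (fun z hz => analyticAt_comp_inv_sub (hd₂ i) fun h => hz (Or.inr h)) hU
      (by simp [(hS₁ x hx).1, (hS₂ x hx).1]) ?_ (by simp [hz₁, hz₂])
    refine (accPt_iff_frequently_nhdsNE.1 (hS_perf x hx)).mono fun y hy => ?_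
    rw [← (hu₁ i).conj_sub_eq_scattered (hent i) (hb₁ i) (hc₁ i) (hn₁ i) (hS₁ y hy).1 (hS₁ y hy).2,
      ← (hu₂ i).conj_sub_eq_scattered (hent i) (hb₂ i) (hc₂ i) (hn₂ i) (hS₂ y hy).1 (hS₂ y hy).2,
      hmeas i hy]
  have hcenter : D₁.center = D₂.center := by
    by_contra hne
    obtain ⟨m, hm⟩ := eventually_atTop.1 (D₁.eventually_refl_ne_zero hN)
    obtain ⟨i, n, hn, hna⟩ := hmodes (m + 1)
    refine hna (coeff_eq_zero_of_taylor_eq_zero (hH i) (ht₁ i) (fun k hk => ?_) n hn)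
    have h0 := eq_zero_of_comp_inv_sub_eq (hd₁ i) (hd₂ i) (D₁.scattered_zero _) hne (hagree i)
    have h1 := congrFun (coeff_unique_of_hasSum (a' := fun _ => 0) (D₁.hasSum_scattered (hb₁ i))
      fun z => by simp [h0 z]) k
    rw [LayeredDisk.scatteredCoeff, if_neg (by omega), map_eq_zero, mul_eq_zero] at h1
    exact h1.resolve_left (by exact_mod_cast hm k (by omega))
  refine ⟨hcenter, fun k => ?_⟩
  refine radius_eq_of_frequently_reflCoeff_eq D₁.radius_pos D₁.radius_strictAnti
    D₁.abs_contrast_lt_one D₁.contrast_ne_zero D₂.radius_pos D₂.radius_strictAnti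
    D₂.abs_contrast_lt_one D₂.contrast_ne_zero (frequently_atTop.2 fun m => ?_) k
  -- Some Taylor coefficient of order `n > m` about the common centre does not vanish.
  obtain ⟨i, n, hn, hbn⟩ : ∃ i n, m + 1 ≤ n ∧ b₁ i n ≠ 0 := by
    by_contra! hcon
    obtain ⟨i, n, hn, hna⟩ := hmodes (m + 1)
    exact hna (coeff_eq_zero_of_taylor_eq_zero (hH i) (ht₁ i) (hcon i) n hn)
  have hbb : b₁ i n = b₂ i n := by
    have h1 := hc₁ i 1 one_pos n
    rw [hcenter, hc₂ i 1 one_pos n] at h1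
    simpa using h1.symm
  have hG : D₁.scattered (b₁ i) = D₂.scattered (b₂ i) := by
    ext ζ
    by_cases hζ : ζ = 0
    · rw [hζ, D₁.scattered_zero, D₂.scattered_zero]
    · have h1 := hagree i (D₁.center + ζ⁻¹) (by simpa using hζ)
        (by rw [← hcenter]; simpa using hζ)
      rw [← hcenter] at h1
      simpa using h1
  have h2 := congrFun (coeff_unique_of_hasSum (D₁.hasSum_scattered (hb₁ i))
    (by rw [hG]; exact D₂.hasSum_scattered (hb₂ i))) n
  rw [LayeredDisk.scatteredCoeff, LayeredDisk.scatteredCoeff, if_neg (by omega), if_neg (by omega),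
    (starRingEnd ℂ).injective.eq_iff, ← hbb] at h2
  have h3 := mul_right_cancel₀ hbn h2
  exact ⟨n, by omega, by exact_mod_cast h3⟩
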